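/- Let $\mathbb K$ be $\mathbb R$ or $\mathbb C$, and let $G$ be a locally compact Hausdorff group with identity $e$, a fixed left Haar measure $ds$, and modular function $\Delta$, normalised by $\Delta(r)\int_G f(sr)\,ds=\int_G f(s)\,ds$. A strongly continuous representation of $G$ on a Banach space $X$ is a homomorphism $U:r\mapsto U_r$ from $G$ into the group of invertible bounded operators on $X$ such that $r\mapsto U_rx$ is continuous for all $x\in X$. Let $\mathcal Z$ be a neighbourhood basis of $e$ contained in a fixed compact set, and let $\nu:G\to[0,\infty)$ be bounded on compact sets and satisfy $\inf_{V\in\mathcal Z}\sup_{r\in V}\nu(r)=1$. Let $\mathcal R$ be a non-empty class of strongly continuous representations of $G$ on Banach spaces over $\mathbb K$ such that $\|U_r\|\le\nu(r)$ for all $U\in\mathcal R$ and $r\in G$. Let $\mathcal X$ be a class of Banach spaces over $\mathbb K$, and suppose that $\mathcal R$ contains the class $\mathcal R'$ of all strongly continuous representations $U$ of $G$ in spaces from $\mathcal X$ such that $\|U_r\|\le\nu(r)$ for all $r\in G$. For a strongly continuous representation $U$ and $f\in C_c(G)$ put $U(f)=\int_G f(s)U_s\,ds$ (a strong operator integral).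 Let $\sigma^{\mathcal R}(f)=\sup_{U\in\mathcal R}\|U(f)\|$, which is a (finite) algebra seminorm on the convolution algebra $C_c(G)=C_c(G,\mathbb K)$; let the Banach algebra $(\mathbb K\rtimes_{\mathrm{triv}}G)^{\mathcal R}$ be the completion of $C_c(G)/\ker\sigma^{\mathcal R}$ in the norm induced by $\sigma^{\mathcal R}$, and let $q^{\mathcal R}$ be the canonical map from $C_c(G)$ into it. For $U\in\mathcal R$, let $U^{\mathcal R}$ be the bounded representation of $(\mathbb K\rtimes_{\mathrm{triv}}G)^{\mathcal R}$ determined by $U^{\mathcal R}(q^{\mathcal R}(f))=U(f)$ for $f\in C_c(G)$. A representation $T$ of an algebra $B$ on $X$ is called non-degenerate if the linear span of $\{T(a)x: a\in B,\ x\in X\}$ is dense in $X$. Then the map $U\mapsto U^{\mathcal R}$ is a bijection between $\mathcal R'$ and the class of non-degenerate contractive representations of $(\mathbb K\rtimes_{\mathrm{triv}}G)^{\mathcal R}$ in the Banach spaces from $\mathcal X$. It preserves the set of closed invariant subspaces: for $U\in\mathcal R'$, a closed subspace is invariant under all $U_r$ if and only if it is invariant under $U^{\mathcal R}$. It preserves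 the Banach space of bounded intertwining operators between two elements of $\mathcal R'$: for $U,V\in\mathcal R'$, a bounded operator intertwines $U$ and $V$ if and only if it intertwines $U^{\mathcal R}$ and $V^{\mathcal R}$. If all elements of $\mathcal R$ are unitary representations on Hilbert spaces, then the involution $f^*(s)=\Delta(s^{-1})\overline{f(s^{-1})}$ of $C_c(G)$ induces an involution on $(\mathbb K\rtimes_{\mathrm{triv}}G)^{\mathcal R}$ satisfying $\|a^*a\|=\|a\|^2$ (so that it is a $C^*$-algebra if $\mathbb K=\mathbb C$), and, for $U\in\mathcal R'$, $U$ is unitary if and only if $U^{\mathcal R}$ is involutive. -/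

import Mathlib

open MeasureTheory Topology NNReal CompactlySupported

noncomputable section

set_option linter.unusedSectionVars false

/-! ### Banach spaces and strongly continuous group representations -/

/-- A bundled Banach space over `𝕂`, so that a class of Banach spaces is a `Set (BanachSp 𝕂)`. -/
structure BanachSp.{w, v} (𝕂 : Type w) [RCLike 𝕂] : Type (max w (v + 1)) where
  carrier : Type v
  [normedAddCommGroup : NormedAddCommGroup carrier]
  [normedSpace : NormedSpace 𝕂 carrier]
  [completeSpace : CompleteSpace carrier]

instance BanachSp.instCoeSort {𝕂 : Type*} [RCLike 𝕂] : CoeSort (BanachSp 𝕂) (Type _) :=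
  ⟨BanachSp.carrier⟩

attribute [instance] BanachSp.normedAddCommGroup BanachSp.normedSpace BanachSp.completeSpace

/-- The underlying real Banach space (needed for the integral). -/
instance BanachSp.instRealNormedSpace {𝕂 : Type*} [RCLike 𝕂] (X : BanachSp 𝕂) :
    NormedSpace ℝ X :=
  NormedSpace.restrictScalars ℝ 𝕂 X

instance BanachSp.instRealScalarTower {𝕂 : Type*} [RCLike 𝕂] (X : BanachSp 𝕂) :
    IsScalarTower ℝ 𝕂 X :=
  IsScalarTower.restrictScalars ℝ 𝕂 X

instance BanachSp.instRealSMulComm {𝕂 : Type*} [RCLike 𝕂] (X : BanachSp 𝕂) :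
    SMulCommClass ℝ 𝕂 X :=
  ⟨fun a b x => by
    change (algebraMap ℝ 𝕂 a) • b • x = b • (algebraMap ℝ 𝕂 a) • x
    rw [smul_comm]⟩

/-- A strongly continuous representation of the group `G` on the Banach space `X`: a homomorphism
into the invertible bounded operators, with continuous orbit maps. -/
structure StrongContRep (G : Type*) [Group G] [TopologicalSpace G] {𝕂 : Type*} [RCLike 𝕂]
    (X : BanachSp 𝕂) where
  toHom : G →* (X →L[𝕂] X)ˣ
  continuous_orbit : ∀ x : X, Continuous fun r : G => (toHom r : X →L[𝕂] X) x

/-- The bounded operator `U_r`. -/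
def StrongContRep.op {G : Type*} [Group G] [TopologicalSpace G] {𝕂 : Type*} [RCLike 𝕂]
    {X : BanachSp 𝕂} (U : StrongContRep G X) (r : G) : X →L[𝕂] X :=
  (U.toHom r : X →L[𝕂] X)

/-- Strongly continuous representations of `G` on arbitrary Banach spaces (together with the
space); a class of strongly continuous representations is a set of these. -/
abbrev SomeRep.{u, w, v} (G : Type u) [Group G] [TopologicalSpace G] (𝕂 : Type w) [RCLike 𝕂] :
    Type (max u w (v + 1)) :=
  Σ X : BanachSp.{w, v} 𝕂, StrongContRep G X

/-- A class of representations is uniformly bounded if it is dominated by some function that is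
bounded on compact sets. -/
def UniformlyBoundedClass {G : Type*} [Group G] [TopologicalSpace G] {𝕂 : Type*} [RCLike 𝕂]
    (R : Set (SomeRep G 𝕂)) : Prop :=
  ∃ ν : G → ℝ≥0, (∀ K : Set G, IsCompact K → BddAbove (ν '' K)) ∧
    ∀ U ∈ R, ∀ r : G, ‖U.2.op r‖ ≤ ν r

section Integrated

open scoped Pointwise

variable {G : Type*} [Group G] [TopologicalSpace G] [IsTopologicalGroup G]
  [MeasurableSpace G] [BorelSpace G] {𝕂 : Type*} [RCLike 𝕂] {X : BanachSp 𝕂}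

theorem StrongContRep.op_mul (U : StrongContRep G X) (r s : G) (x : X) :
    U.op (r * s) x = U.op r (U.op s x) := by
  simp [StrongContRep.op]

theorem StrongContRep.continuous_op (U : StrongContRep G X) (x : X) :
    Continuous fun r => U.op r x :=
  U.continuous_orbit x

theorem StrongContRep.exists_bound (U : StrongContRep G X) {K : Set G} (hK : IsCompact K) :
    ∃ M : ℝ, 0 ≤ M ∧ ∀ r ∈ K, ‖U.op r‖ ≤ M := by
  have h := banach_steinhaus (g := fun r : K => U.op r) (fun x => by
    obtain ⟨C, hC⟩ := hK.exists_bound_of_continuousOn (U.continuous_op x).continuousOn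
    exact ⟨C, fun r => hC r r.2⟩)
  obtain ⟨M, hM⟩ := h
  exact ⟨max M 0, le_max_right _ _, fun r hr => (hM ⟨r, hr⟩).trans (le_max_left _ _)⟩

theorem StrongContRep.integrable (U : StrongContRep G X) (μ : Measure G)
    [IsFiniteMeasureOnCompacts μ] (f : C_c(G, 𝕂)) (x : X) :
    Integrable (fun s => f s • U.op s x) μ :=
  ((map_continuous f).smul (U.continuous_op x)).integrable_of_hasCompactSupport
    f.hasCompactSupport.smul_right

theorem StrongContRep.norm_integral_le (U : StrongContRep G X) (μ : Measure G)
    [IsFiniteMeasureOnCompacts μ] (f : C_c(G, 𝕂)) (x : X) {M : ℝ}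
    (hM : ∀ r ∈ tsupport f, ‖U.op r‖ ≤ M) :
    ‖∫ s, f s • U.op s x ∂μ‖ ≤ (M * ∫ s, ‖f s‖ ∂μ) * ‖x‖ := by
  have hf : Integrable (fun s => ‖f s‖) μ :=
    ((map_continuous f).integrable_of_hasCompactSupport f.hasCompactSupport).norm
  calc ‖∫ s, f s • U.op s x ∂μ‖ ≤ ∫ s, ‖f s • U.op s x‖ ∂μ := norm_integral_le_integral_norm _
    _ ≤ ∫ s, (M * ‖x‖) * ‖f s‖ ∂μ := by
        refine integral_mono (U.integrable μ f x).norm (hf.const_mul _) fun s => ?_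
        by_cases hs : s ∈ tsupport f
        · have h1 : ‖U.op s x‖ ≤ M * ‖x‖ := (U.op s).le_of_opNorm_le (hM s hs) x
          calc ‖f s • U.op s x‖ = ‖U.op s x‖ * ‖f s‖ := by rw [norm_smul, mul_comm]
            _ ≤ (M * ‖x‖) * ‖f s‖ := by gcongr
        · simp [image_eq_zero_of_notMem_tsupport hs]
    _ = (M * ∫ s, ‖f s‖ ∂μ) * ‖x‖ := by rw [integral_const_mul]; ring

/-- The integrated form `U(f) = ∫ f(s) U_s ds`, the integral being taken in the strong sense:
`U(f) x = ∫ f(s) U_s x ds`. -/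
def StrongContRep.integrate (μ : Measure G) [IsFiniteMeasureOnCompacts μ]
    (U : StrongContRep G X) (f : C_c(G, 𝕂)) : X →L[𝕂] X :=
  LinearMap.mkContinuousOfExistsBound
    { toFun := fun x => ∫ s, f s • U.op s x ∂μ
      map_add' := fun x y => by
        simp only [map_add, smul_add]
        exact integral_add (U.integrable μ f x) (U.integrable μ f y)
      map_smul' := fun c x => by
        simp only [map_smul, smul_comm _ c, RingHom.id_apply]
        exact integral_smul c _ }
    (by
      obtain ⟨M, -, hM⟩ := U.exists_bound f.hasCompactSupport.isCompact
      exact ⟨_, fun x => U.norm_integral_le μ f x hM⟩)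

theorem StrongContRep.integrate_apply (μ : Measure G) [IsFiniteMeasureOnCompacts μ]
    (U : StrongContRep G X) (f : C_c(G, 𝕂)) (x : X) :
    U.integrate μ f x = ∫ s, f s • U.op s x ∂μ := rfl

theorem StrongContRep.norm_integrate_le (μ : Measure G) [IsFiniteMeasureOnCompacts μ]
    (U : StrongContRep G X) (f : C_c(G, 𝕂)) {M : ℝ} (h0 : 0 ≤ M)
    (hM : ∀ r ∈ tsupport f, ‖U.op r‖ ≤ M) :
    ‖U.integrate μ f‖ ≤ M * ∫ s, ‖f s‖ ∂μ :=
  ContinuousLinearMap.opNorm_le_bound _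
    (mul_nonneg h0 (integral_nonneg fun _ => norm_nonneg _))
    fun x => U.norm_integral_le μ f x hM

theorem StrongContRep.integrate_add (μ : Measure G) [IsFiniteMeasureOnCompacts μ]
    (U : StrongContRep G X) (f g : C_c(G, 𝕂)) :
    U.integrate μ (f + g) = U.integrate μ f + U.integrate μ g := by
  ext x
  simp only [integrate_apply, _root_.add_apply,
    CompactlySupportedContinuousMap.coe_add, Pi.add_apply, add_smul]
  exact integral_add (U.integrable μ f x) (U.integrable μ g x)

theorem StrongContRep.integrate_smul (μ : Measure G) [IsFiniteMeasureOnCompacts μ]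
    (U : StrongContRep G X) (c : 𝕂) (f : C_c(G, 𝕂)) :
    U.integrate μ (c • f) = c • U.integrate μ f := by
  ext x
  simp only [integrate_apply, _root_.smul_apply,
    CompactlySupportedContinuousMap.coe_smul, Pi.smul_apply, smul_assoc]
  exact integral_smul c _

/-! ### Convolution on `C_c(G)` -/

theorem convolution_continuous [LocallyCompactSpace G] (μ : Measure G)
    [IsFiniteMeasureOnCompacts μ] (f g : C_c(G, 𝕂)) :
    Continuous fun s => ∫ r, f r * g (r⁻¹ * s) ∂μ := by
  rw [← continuousOn_univ]
  refine continuousOn_integral_of_compact_support (k := tsupport f)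
    f.hasCompactSupport.isCompact ?_ ?_
  · refine Continuous.continuousOn ?_
    exact ((map_continuous f).comp continuous_snd).mul
      ((map_continuous g).comp (continuous_snd.inv.mul continuous_fst))
  · intro s r _ hr
    simp [image_eq_zero_of_notMem_tsupport hr]

/-- The convolution product `(f * g)(s) = ∫ f(r) g(r⁻¹ s) dr` on `C_c(G)`. -/
def groupConvolution [LocallyCompactSpace G] (μ : Measure G)
    [IsFiniteMeasureOnCompacts μ] (f g : C_c(G, 𝕂)) : C_c(G, 𝕂) where
  toFun := fun s => ∫ r, f r * g (r⁻¹ * s) ∂μ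
  continuous_toFun := convolution_continuous μ f g
  hasCompactSupport' := by
    refine HasCompactSupport.intro
      (f.hasCompactSupport.isCompact.mul g.hasCompactSupport.isCompact) fun s hs => ?_
    refine integral_eq_zero_of_ae (Filter.Eventually.of_forall fun r => ?_)
    by_cases hr : r ∈ tsupport f
    · have : r⁻¹ * s ∉ tsupport g := fun h => hs ⟨r, hr, r⁻¹ * s, h, by simp⟩
      simp [image_eq_zero_of_notMem_tsupport this]
    · simp [image_eq_zero_of_notMem_tsupport hr]


theorem integral_groupConvolution_smul [LocallyCompactSpace G] (μ : Measure G) [μ.IsHaarMeasure]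
    (f g : C_c(G, 𝕂)) {E : Type*} [NormedAddCommGroup E] [NormedSpace ℝ E] [NormedSpace 𝕂 E]
    [CompleteSpace E] [IsScalarTower ℝ 𝕂 E] [SMulCommClass ℝ 𝕂 E] {φ : G → E}
    (hφ : Continuous φ) :
    ∫ s, groupConvolution μ f g s • φ s ∂μ = ∫ r, f r • ∫ s, g s • φ (r * s) ∂μ ∂μ := by
  have hsupp : ∀ p : G × G, p ∉ (tsupport f * tsupport g) ×ˢ tsupport f →
      (f p.2 * g (p.2⁻¹ * p.1)) • φ p.1 = 0 := by
    rintro ⟨s, r⟩ h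
    by_cases hr : r ∈ tsupport f
    · have : r⁻¹ * s ∉ tsupport g := fun h' => h ⟨⟨r, hr, r⁻¹ * s, h', by simp⟩, hr⟩
      simp [image_eq_zero_of_notMem_tsupport this]
    · simp [image_eq_zero_of_notMem_tsupport hr]
  calc ∫ s, groupConvolution μ f g s • φ s ∂μ
      = ∫ s, ∫ r, (f r * g (r⁻¹ * s)) • φ s ∂μ ∂μ := by
        congr 1 with s
        exact (integral_smul_const _ _).symm
    _ = ∫ r, ∫ s, (f r * g (r⁻¹ * s)) • φ s ∂μ ∂μ := by
        apply integral_integral_swap_of_hasCompactSupport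
        · exact (((map_continuous f).comp continuous_snd).mul
            ((map_continuous g).comp (continuous_snd.inv.mul continuous_fst))).smul
            (hφ.comp continuous_fst)
        · exact HasCompactSupport.of_support_subset_isCompact
            ((f.hasCompactSupport.isCompact.mul g.hasCompactSupport.isCompact).prod
              f.hasCompactSupport.isCompact)
            (fun p hp => by by_contra h; exact hp (hsupp p h))
    _ = ∫ r, f r • ∫ s, g s • φ (r * s) ∂μ ∂μ := by
        congr 1 with r
        simp only [mul_smul]
        rw [integral_smul]
        congr 1
        rw [← integral_mul_left_eq_self _ r]
        simp

theorem groupConvolution_assoc [LocallyCompactSpace G] (μ : Measure G) [μ.IsHaarMeasure]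
    (f g h : C_c(G, 𝕂)) :
    groupConvolution μ (groupConvolution μ f g) h =
      groupConvolution μ f (groupConvolution μ g h) := by
  ext t
  have := integral_groupConvolution_smul μ f g (φ := fun s => h (s⁻¹ * t))
    ((map_continuous h).comp (continuous_inv.mul continuous_const))
  simpa [groupConvolution, mul_assoc] using this

theorem StrongContRep.integrate_groupConvolution [LocallyCompactSpace G] (μ : Measure G)
    [μ.IsHaarMeasure] (U : StrongContRep G X) (f g : C_c(G, 𝕂)) :
    U.integrate μ (groupConvolution μ f g) = U.integrate μ f * U.integrate μ g := by
  ext x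
  change U.integrate μ _ x = U.integrate μ f (U.integrate μ g x)
  simp only [integrate_apply]
  rw [integral_groupConvolution_smul μ f g (U.continuous_op x)]
  congr 1 with r
  congr 1
  rw [← ContinuousLinearMap.integral_comp_comm _ (U.integrable μ g x)]
  simp [U.op_mul]

theorem convolution_integrable (μ : Measure G) [IsFiniteMeasureOnCompacts μ] (f g : C_c(G, 𝕂))
    (s : G) : Integrable (fun r => f r * g (r⁻¹ * s)) μ :=
  ((map_continuous f).mul ((map_continuous g).comp
    (continuous_inv.mul continuous_const))).integrable_of_hasCompactSupport
    f.hasCompactSupport.mul_right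

end Integrated

/-! ### The completion of a non-unital seminormed algebra -/

section Completion

open UniformSpace

variable {A : Type*} [NonUnitalSeminormedRing A]

/-- Left multiplication, valued in the completion, as a continuous biadditive map. -/
theorem completion_continuous_mul :
    Continuous fun p : A × A => ((AddMonoidHom.mul : A →+ A →+ A).compr₂ Completion.toCompl)
      p.1 p.2 :=
  (Completion.continuous_coe A).comp continuous_mul

/-- The multiplication of the completion: the continuous extension of that of `A`. -/
def completionMul (a b : Completion A) : Completion A :=
  (Completion.isDenseInducing_coe.prodMap Completion.isDenseInducing_coe).extend
    (fun p : A × A => ((p.1 * p.2 : A) : Completion A)) (a, b)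

theorem completionMul_coe (a b : A) :
    completionMul (a : Completion A) (b : Completion A) = ((a * b : A) : Completion A) :=
  (Completion.isDenseInducing_coe.prodMap Completion.isDenseInducing_coe).extend_eq
    ((Completion.continuous_coe A).comp continuous_mul) (a, b)

theorem continuous_completionMul :
    Continuous fun p : Completion A × Completion A => completionMul p.1 p.2 :=
  have di : IsDenseInducing (Completion.toCompl : A → Completion A) :=
    Completion.isDenseInducing_coe
  (di.extend_Z_bilin di completion_continuous_mul :)

theorem continuous_completionMul' {Y : Type*} [TopologicalSpace Y] {f g : Y → Completion A}
    (hf : Continuous f) (hg : Continuous g) : Continuous fun y => completionMul (f y) (g y) :=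
  continuous_completionMul.comp (hf.prodMk hg)

theorem completionMul_add (a b c : Completion A) :
    completionMul a (b + c) = completionMul a b + completionMul a c := by
  refine Completion.induction_on₃ a b c (isClosed_eq ?_ ?_) fun a b c => ?_
  · refine continuous_completionMul' ?_ ?_ <;> fun_prop
  · refine Continuous.add ?_ ?_ <;> refine continuous_completionMul' ?_ ?_ <;> fun_prop
  · rw [← Completion.coe_add, completionMul_coe, completionMul_coe, completionMul_coe, mul_add,
      Completion.coe_add]

theorem add_completionMul (a b c : Completion A) :
    completionMul (a + b) c = completionMul a c + completionMul b c := by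
  refine Completion.induction_on₃ a b c (isClosed_eq ?_ ?_) fun a b c => ?_
  · refine continuous_completionMul' ?_ ?_ <;> fun_prop
  · refine Continuous.add ?_ ?_ <;> refine continuous_completionMul' ?_ ?_ <;> fun_prop
  · rw [← Completion.coe_add, completionMul_coe, completionMul_coe, completionMul_coe, add_mul,
      Completion.coe_add]

/-- The completion of a non-unital seminormed ring is a non-unital normed ring. -/
@[reducible]
def completionNonUnitalNormedRing : NonUnitalNormedRing (Completion A) where
  __ : NormedAddCommGroup (Completion A) := inferInstance
  mul := completionMul
  left_distrib := completionMul_add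
  right_distrib := add_completionMul
  zero_mul a := by
    refine Completion.induction_on a (isClosed_eq
      (continuous_completionMul' continuous_const continuous_id) continuous_const) fun a => ?_
    change completionMul 0 _ = 0
    rw [← Completion.coe_zero, completionMul_coe, zero_mul]
  mul_zero a := by
    refine Completion.induction_on a (isClosed_eq
      (continuous_completionMul' continuous_id continuous_const) continuous_const) fun a => ?_
    change completionMul _ 0 = 0
    rw [← Completion.coe_zero, completionMul_coe, mul_zero]
  mul_assoc a b c := by
    refine Completion.induction_on₃ a b c (isClosed_eq
      (continuous_completionMul' (continuous_completionMul' (by fun_prop) (by fun_prop))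
        (by fun_prop))
      (continuous_completionMul' (by fun_prop)
        (continuous_completionMul' (by fun_prop) (by fun_prop)))) fun a b c => ?_
    change completionMul (completionMul _ _) _ = completionMul _ (completionMul _ _)
    rw [completionMul_coe, completionMul_coe, completionMul_coe, completionMul_coe, mul_assoc]
  norm_mul_le a b := by
    refine Completion.induction_on₂ a b (isClosed_le
      (continuous_completionMul' (by fun_prop) (by fun_prop)).norm (by fun_prop)) fun a b => ?_
    change ‖completionMul _ _‖ ≤ _
    rw [completionMul_coe, Completion.norm_coe, Completion.norm_coe, Completion.norm_coe]
    exact norm_mul_le a b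

theorem completionMul_smul_left {𝕜 : Type*} [NormedField 𝕜] [NormedSpace 𝕜 A]
    [IsScalarTower 𝕜 A A] (c : 𝕜) (a b : Completion A) :
    completionMul (c • a) b = c • completionMul a b := by
  refine Completion.induction_on₂ a b (isClosed_eq ?_ ?_) fun a b => ?_
  · exact continuous_completionMul' (continuous_fst.const_smul c) continuous_snd
  · exact continuous_completionMul.const_smul c
  · rw [← Completion.coe_smul, completionMul_coe, completionMul_coe, smul_mul_assoc,
      Completion.coe_smul]

theorem completionMul_smul_right {𝕜 : Type*} [NormedField 𝕜] [NormedSpace 𝕜 A]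
    [SMulCommClass 𝕜 A A] (c : 𝕜) (a b : Completion A) :
    completionMul a (c • b) = c • completionMul a b := by
  refine Completion.induction_on₂ a b (isClosed_eq ?_ ?_) fun a b => ?_
  · exact continuous_completionMul' continuous_fst (continuous_snd.const_smul c)
  · exact continuous_completionMul.const_smul c
  · rw [← Completion.coe_smul, completionMul_coe, completionMul_coe, mul_smul_comm,
      Completion.coe_smul]

end Completion

/-! ### The seminorm and the convolution algebra -/

section Algebra

variable {G : Type*} [Group G] [TopologicalSpace G] [IsTopologicalGroup G] [LocallyCompactSpace G]
  [MeasurableSpace G] [BorelSpace G] {𝕂 : Type*} [RCLike 𝕂]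

/-- The seminorm `σ(f) = sup_{U ∈ R} ‖U(f)‖` on `C_c(G)`. -/
def classSeminorm (μ : Measure G) [IsFiniteMeasureOnCompacts μ] (R : Set (SomeRep G 𝕂))
    (f : C_c(G, 𝕂)) : ℝ :=
  ⨆ U : R, ‖U.1.2.integrate μ f‖

theorem classSeminorm_bddAbove (μ : Measure G) [IsFiniteMeasureOnCompacts μ]
    {R : Set (SomeRep G 𝕂)} (hR : UniformlyBoundedClass R) (f : C_c(G, 𝕂)) :
    BddAbove (Set.range fun U : R => ‖U.1.2.integrate μ f‖) := by
  obtain ⟨ν, hν, hU⟩ := hR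
  obtain ⟨M, hM⟩ := hν _ f.hasCompactSupport.isCompact
  refine ⟨M * ∫ s, ‖f s‖ ∂μ, ?_⟩
  rintro _ ⟨U, rfl⟩
  exact U.1.2.norm_integrate_le μ f M.2 fun r hr =>
    (hU U.1 U.2 r).trans (NNReal.coe_le_coe.2 (hM ⟨r, hr, rfl⟩))

theorem norm_integrate_le_classSeminorm (μ : Measure G) [IsFiniteMeasureOnCompacts μ]
    {R : Set (SomeRep G 𝕂)} (hR : UniformlyBoundedClass R) {U : SomeRep G 𝕂} (hU : U ∈ R)
    (f : C_c(G, 𝕂)) : ‖U.2.integrate μ f‖ ≤ classSeminorm μ R f :=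
  le_ciSup (classSeminorm_bddAbove μ hR f) (⟨U, hU⟩ : R)

theorem classSeminorm_nonneg (μ : Measure G) [IsFiniteMeasureOnCompacts μ]
    (R : Set (SomeRep G 𝕂)) (f : C_c(G, 𝕂)) : 0 ≤ classSeminorm μ R f :=
  Real.iSup_nonneg fun _ => norm_nonneg _

/-- The convolution algebra `C_c(G)`, to be equipped with the seminorm given by `R`. -/
def ConvAlg (μ : Measure G) [μ.IsHaarMeasure] (R : Set (SomeRep G 𝕂))
    (_hR : UniformlyBoundedClass R) : Type _ :=
  C_c(G, 𝕂)

variable (μ : Measure G) [μ.IsHaarMeasure] (R : Set (SomeRep G 𝕂)) (hR : UniformlyBoundedClass R)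

instance ConvAlg.instAddCommGroup : AddCommGroup (ConvAlg μ R hR) :=
  inferInstanceAs (AddCommGroup C_c(G, 𝕂))

instance ConvAlg.instModule : Module 𝕂 (ConvAlg μ R hR) :=
  inferInstanceAs (Module 𝕂 C_c(G, 𝕂))

/-- The multiplication of the convolution algebra is convolution. -/
instance ConvAlg.instMul : Mul (ConvAlg μ R hR) :=
  ⟨fun f g => groupConvolution (𝕂 := 𝕂) μ f g⟩

instance ConvAlg.instNonUnitalRing : NonUnitalRing (ConvAlg μ R hR) where
  __ := ConvAlg.instAddCommGroup μ R hR
  __ := ConvAlg.instMul μ R hR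
  left_distrib f g h := CompactlySupportedContinuousMap.ext (α := G) (β := 𝕂) fun s => by
    refine Eq.trans ?_ (integral_add (convolution_integrable (𝕂 := 𝕂) μ f g s)
      (convolution_integrable (𝕂 := 𝕂) μ f h s))
    exact integral_congr_ae (Filter.Eventually.of_forall fun r => mul_add _ _ _)
  right_distrib f g h := CompactlySupportedContinuousMap.ext (α := G) (β := 𝕂) fun s => by
    refine Eq.trans ?_ (integral_add (convolution_integrable (𝕂 := 𝕂) μ f h s)
      (convolution_integrable (𝕂 := 𝕂) μ g h s))
    exact integral_congr_ae (Filter.Eventually.of_forall fun r => add_mul _ _ _)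
  zero_mul f := CompactlySupportedContinuousMap.ext (α := G) (β := 𝕂) fun s =>
    integral_eq_zero_of_ae (Filter.Eventually.of_forall fun r => zero_mul _)
  mul_zero f := CompactlySupportedContinuousMap.ext (α := G) (β := 𝕂) fun s =>
    integral_eq_zero_of_ae (Filter.Eventually.of_forall fun r => mul_zero _)
  mul_assoc f g h := groupConvolution_assoc (𝕂 := 𝕂) μ f g h

instance ConvAlg.instIsScalarTower : IsScalarTower 𝕂 (ConvAlg μ R hR) (ConvAlg μ R hR) where
  smul_assoc c f g := CompactlySupportedContinuousMap.ext (α := G) (β := 𝕂) fun s => by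
    refine Eq.trans ?_ (integral_smul c _)
    exact integral_congr_ae (Filter.Eventually.of_forall fun r => smul_mul_assoc c _ _)

instance ConvAlg.instSMulCommClass : SMulCommClass 𝕂 (ConvAlg μ R hR) (ConvAlg μ R hR) where
  smul_comm c f g := CompactlySupportedContinuousMap.ext (α := G) (β := 𝕂) fun s => by
    refine Eq.symm (Eq.trans ?_ (integral_smul c _))
    exact integral_congr_ae (Filter.Eventually.of_forall fun r => mul_smul_comm c _ _)

/-- The integrated form as a representation of the convolution algebra. -/
def StrongContRep.integrateHom {X : BanachSp 𝕂} (U : StrongContRep G X) :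
    ConvAlg μ R hR →ₙₐ[𝕂] (X →L[𝕂] X) where
  toFun := fun f => U.integrate μ f
  map_smul' := fun c f => U.integrate_smul μ c f
  map_zero' := by
    have := U.integrate_smul μ (0 : 𝕂) (0 : C_c(G, 𝕂))
    rwa [zero_smul, zero_smul] at this
  map_add' := fun f g => U.integrate_add μ f g
  map_mul' := fun f g => U.integrate_groupConvolution μ f g

instance ConvAlg.instSeminormedAddCommGroup : SeminormedAddCommGroup (ConvAlg μ R hR) :=
  AddGroupSeminorm.toSeminormedAddCommGroup
    { toFun := fun f => classSeminorm μ R f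
      map_zero' := by
        refine le_antisymm (Real.iSup_le (fun U => ?_) le_rfl) (classSeminorm_nonneg μ R _)
        exact (norm_eq_zero.2 (map_zero (U.1.2.integrateHom μ R hR))).le
      add_le' := fun f g => Real.iSup_le (fun U => by
        rw [show U.1.2.integrate μ (f + g) = _ from map_add (U.1.2.integrateHom μ R hR) f g]
        exact (norm_add_le _ _).trans (add_le_add
          (norm_integrate_le_classSeminorm μ hR U.2 f)
          (norm_integrate_le_classSeminorm μ hR U.2 g)))
        (add_nonneg (classSeminorm_nonneg μ R f) (classSeminorm_nonneg μ R g))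
      neg' := fun f => by
        refine congrArg iSup (funext fun U => ?_)
        rw [show U.1.2.integrate μ (-f) = _ from map_neg (U.1.2.integrateHom μ R hR) f]
        exact norm_neg _ }

theorem ConvAlg.norm_def (f : ConvAlg μ R hR) : ‖f‖ = classSeminorm μ R f := rfl

instance ConvAlg.instNonUnitalSeminormedRing : NonUnitalSeminormedRing (ConvAlg μ R hR) where
  __ := ConvAlg.instSeminormedAddCommGroup μ R hR
  __ := ConvAlg.instNonUnitalRing μ R hR
  norm_mul_le f g := Real.iSup_le (fun U => by
    rw [show U.1.2.integrate μ (f * g) = _ from map_mul (U.1.2.integrateHom μ R hR) f g]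
    exact (norm_mul_le _ _).trans (mul_le_mul
      (norm_integrate_le_classSeminorm μ hR U.2 f)
      (norm_integrate_le_classSeminorm μ hR U.2 g) (norm_nonneg _) (norm_nonneg _)))
    (mul_nonneg (norm_nonneg f) (norm_nonneg g))

instance ConvAlg.instNormedSpace : NormedSpace 𝕂 (ConvAlg μ R hR) where
  norm_smul_le c f := Real.iSup_le (fun U => by
    rw [show U.1.2.integrate μ (c • f) = _ from map_smul (U.1.2.integrateHom μ R hR) c f,
      norm_smul]
    exact mul_le_mul_of_nonneg_left (norm_integrate_le_classSeminorm μ hR U.2 f) (norm_nonneg _))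
    (mul_nonneg (norm_nonneg c) (norm_nonneg f))

/-- The crossed product `(𝕂 ⋊_triv G)^R`: the (Hausdorff) completion of the convolution algebra
`C_c(G)` in the seminorm `σ`, i.e. the completion of `C_c(G) / ker σ`. -/
def CrossedProduct : Type _ := UniformSpace.Completion (ConvAlg μ R hR)

instance CrossedProduct.instNonUnitalNormedRing : NonUnitalNormedRing (CrossedProduct μ R hR) :=
  completionNonUnitalNormedRing (A := ConvAlg μ R hR)

instance CrossedProduct.instNormedSpace : NormedSpace 𝕂 (CrossedProduct μ R hR) :=
  inferInstanceAs (NormedSpace 𝕂 (UniformSpace.Completion (ConvAlg μ R hR)))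

instance CrossedProduct.instCompleteSpace : CompleteSpace (CrossedProduct μ R hR) :=
  inferInstanceAs (CompleteSpace (UniformSpace.Completion (ConvAlg μ R hR)))

instance CrossedProduct.instIsScalarTower :
    IsScalarTower 𝕂 (CrossedProduct μ R hR) (CrossedProduct μ R hR) :=
  ⟨fun c a b => completionMul_smul_left (A := ConvAlg μ R hR) c a b⟩

instance CrossedProduct.instSMulCommClass :
    SMulCommClass 𝕂 (CrossedProduct μ R hR) (CrossedProduct μ R hR) :=
  ⟨fun c a b => (completionMul_smul_right (A := ConvAlg μ R hR) c a b).symm⟩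

/-- The canonical homomorphism `q : C_c(G) → (𝕂 ⋊_triv G)^R`. -/
def CrossedProduct.q : ConvAlg μ R hR →ₙₐ[𝕂] CrossedProduct μ R hR where
  toFun := fun f => ((f : UniformSpace.Completion (ConvAlg μ R hR)))
  map_smul' := fun c f => UniformSpace.Completion.coe_smul c f
  map_zero' := UniformSpace.Completion.coe_zero
  map_add' := fun f g => UniformSpace.Completion.coe_add f g
  map_mul' := fun f g => (completionMul_coe f g).symm

theorem CrossedProduct.denseRange_q : DenseRange (CrossedProduct.q μ R hR) :=
  UniformSpace.Completion.denseRange_coe (α := ConvAlg μ R hR)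

theorem CrossedProduct.norm_q (f : ConvAlg μ R hR) :
    ‖CrossedProduct.q μ R hR f‖ = classSeminorm μ R f :=
  UniformSpace.Completion.norm_coe (E := ConvAlg μ R hR) f

variable {R}

/-- `U` is `R`-continuous if `‖U(f)‖ ≤ C σ(f)` for some constant `C`. -/
def StrongContRep.ContinuousFor (R : Set (SomeRep G 𝕂)) {X : BanachSp 𝕂}
    (U : StrongContRep G X) : Prop :=
  ∃ C : ℝ, ∀ f : C_c(G, 𝕂), ‖U.integrate μ f‖ ≤ C * classSeminorm μ R f

theorem continuousFor_of_mem (hR : UniformlyBoundedClass R) {U : SomeRep G 𝕂} (hU : U ∈ R) :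
    U.2.ContinuousFor μ R :=
  ⟨1, fun f => by rw [one_mul]; exact norm_integrate_le_classSeminorm μ hR hU f⟩

/-- The bounded operator `(𝕂 ⋊_triv G)^R → B(X)` extending `q(f) ↦ U(f)`. -/
def StrongContRep.inducedMap {X : BanachSp 𝕂} (U : StrongContRep G X) :
    CrossedProduct μ R hR →L[𝕂] (X →L[𝕂] X) :=
  LinearMap.extendOfNorm (U.integrateHom μ R hR : ConvAlg μ R hR →ₗ[𝕂] (X →L[𝕂] X))
    (CrossedProduct.q μ R hR : ConvAlg μ R hR →ₗ[𝕂] CrossedProduct μ R hR)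

theorem StrongContRep.inducedMap_q {X : BanachSp 𝕂} (U : StrongContRep G X)
    (hU : U.ContinuousFor μ R) (f : ConvAlg μ R hR) :
    U.inducedMap μ hR (CrossedProduct.q μ R hR f) = U.integrate μ f := by
  obtain ⟨C, hC⟩ := hU
  exact LinearMap.extendOfNorm_eq (CrossedProduct.denseRange_q μ R hR)
    ⟨C, fun f => by
      refine (hC f).trans_eq ?_
      rw [← CrossedProduct.norm_q μ R hR f]
      rfl⟩ f

/-- The representation `U^R` of `(𝕂 ⋊_triv G)^R` associated with an `R`-continuous `U`;
it is determined by `U^R(q(f)) = U(f)` for `f ∈ C_c(G)`. -/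
def StrongContRep.induced {X : BanachSp 𝕂} (U : StrongContRep G X)
    (hU : U.ContinuousFor μ R) : CrossedProduct μ R hR →ₙₐ[𝕂] (X →L[𝕂] X) where
  toFun := U.inducedMap μ hR
  map_smul' := fun c a => map_smul (U.inducedMap μ hR) c a
  map_zero' := map_zero _
  map_add' := fun a b => map_add _ a b
  map_mul' := fun a b => by
    refine (CrossedProduct.denseRange_q μ R hR).induction_on₂
      (p := fun a b => U.inducedMap μ hR (a * b) = U.inducedMap μ hR a * U.inducedMap μ hR b)
      (isClosed_eq (by fun_prop) (by fun_prop)) (fun f g => ?_) a b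
    rw [← map_mul, U.inducedMap_q μ hR hU, U.inducedMap_q μ hR hU, U.inducedMap_q μ hR hU]
    exact map_mul (U.integrateHom μ R hR) f g

theorem StrongContRep.induced_q {X : BanachSp 𝕂} (U : StrongContRep G X)
    (hU : U.ContinuousFor μ R) (f : ConvAlg μ R hR) :
    U.induced μ hR hU (CrossedProduct.q μ R hR f) = U.integrate μ f :=
  U.inducedMap_q μ hR hU f

end Algebra

/-! ### Properties of representations -/

section Representations

variable {𝕂 : Type*} [RCLike 𝕂] {X Y : BanachSp 𝕂}

/-- A representation of an algebra on `X` is non-degenerate if the vectors `T(a)x` span a dense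
subspace of `X`. -/
def IsNondegenerateRep {B : Type*} [NonUnitalNormedRing B] [NormedSpace 𝕂 B]
    (T : B →ₙₐ[𝕂] (X →L[𝕂] X)) : Prop :=
  Dense (Submodule.span 𝕂 {y : X | ∃ (a : B) (x : X), y = T a x} : Set X)

/-- A representation of a normed algebra is contractive if it has norm at most one. -/
def IsContractiveRep {B : Type*} [NonUnitalNormedRing B] [NormedSpace 𝕂 B]
    (T : B →ₙₐ[𝕂] (X →L[𝕂] X)) : Prop :=
  ∀ a : B, ‖T a‖ ≤ ‖a‖

/-- A subspace is invariant under a family of operators. -/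
def IsInvariantUnder {ι : Type*} (S : ι → (X →L[𝕂] X)) (Z : Submodule 𝕂 X) : Prop :=
  ∀ i, ∀ x ∈ Z, S i x ∈ Z

/-- A bounded operator intertwines two families of operators. -/
def Intertwines {ι : Type*} (S : ι → (X →L[𝕂] X)) (T : ι → (Y →L[𝕂] Y)) (Φ : X →L[𝕂] Y) :
    Prop :=
  ∀ i, (T i).comp Φ = Φ.comp (S i)

/-- A Hilbert space structure on the Banach space `X`: an inner product inducing its norm.
(There is at most one.) -/
structure HilbertStructure (X : BanachSp 𝕂) where
  innerProductSpace : InnerProductSpace 𝕂 X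
  compatible : innerProductSpace.toNormedSpace = X.normedSpace

/-- The inner product, conjugate-linear in the first variable. -/
def HilbertStructure.ip (H : HilbertStructure X) (x y : X) : 𝕂 :=
  H.innerProductSpace.inner x y

/-- `U` is a unitary representation: `X` is a Hilbert space, and the (invertible) operators `U_r`
preserve its inner product. -/
def IsUnitaryRep {G : Type*} [Group G] [TopologicalSpace G] (U : StrongContRep G X) : Prop :=
  ∃ H : HilbertStructure X, ∀ (r : G) (x y : X), H.ip (U.op r x) (U.op r y) = H.ip x y

/-- `T` is an involutive representation: `X` is a Hilbert space, and `T(a*)` is the adjoint of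
`T(a)`. -/
def IsInvolutiveRep {B : Type*} [NonUnitalNormedRing B] [NormedSpace 𝕂 B] [Star B]
    (T : B →ₙₐ[𝕂] (X →L[𝕂] X)) : Prop :=
  ∃ H : HilbertStructure X, ∀ (a : B) (x y : X), H.ip (T a x) y = H.ip x (T (star a) y)

end Representations

/-! ### The two classes of representations and the map between them -/

/-- Representations of the algebra `B` on arbitrary Banach spaces (together with the space). -/
abbrev SomeAlgRep.{u, w, v} {𝕂 : Type w} [RCLike 𝕂] (B : Type u) [NonUnitalNormedRing B]
    [NormedSpace 𝕂 B] : Type (max u w (v + 1)) :=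
  Σ X : BanachSp.{w, v} 𝕂, B →ₙₐ[𝕂] (X →L[𝕂] X)

/-- The class of all strongly continuous representations `U` of `G` in spaces from `𝓧` with
`‖U_r‖ ≤ ν(r)` for all `r`. -/
def boundedReps {G : Type*} [Group G] [TopologicalSpace G] {𝕂 : Type*} [RCLike 𝕂]
    (𝓧 : Set (BanachSp 𝕂)) (ν : G → ℝ≥0) : Set (SomeRep G 𝕂) :=
  {U | U.1 ∈ 𝓧 ∧ ∀ r : G, ‖U.2.op r‖ ≤ ν r}

/-- The class of all non-degenerate contractive representations of `B` in spaces from `𝓧`. -/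
def nondegContractiveReps {𝕂 : Type*} [RCLike 𝕂] (B : Type*) [NonUnitalNormedRing B]
    [NormedSpace 𝕂 B] (𝓧 : Set (BanachSp 𝕂)) : Set (SomeAlgRep (𝕂 := 𝕂) B) :=
  {T | T.1 ∈ 𝓧 ∧ IsNondegenerateRep T.2 ∧ IsContractiveRep T.2}

/-- The assignment `U ↦ U^R`, for `U ∈ R`. -/
def inducedRep {G : Type*} [Group G] [TopologicalSpace G] [IsTopologicalGroup G]
    [LocallyCompactSpace G] [MeasurableSpace G] [BorelSpace G] {𝕂 : Type*} [RCLike 𝕂]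
    (μ : Measure G) [μ.IsHaarMeasure] {R : Set (SomeRep G 𝕂)} (hR : UniformlyBoundedClass R)
    (U : SomeRep G 𝕂) (hU : U ∈ R) : SomeAlgRep (𝕂 := 𝕂) (CrossedProduct μ R hR) :=
  ⟨U.1, U.2.induced μ hR (continuousFor_of_mem μ hR hU)⟩

/-! ### The involution on `C_c(G)` -/

section Involution

variable {G : Type*} [Group G] [TopologicalSpace G] [IsTopologicalGroup G] [LocallyCompactSpace G]

/-- The modular function `Δ`, normalised by `Δ(r) ∫ f(s r) ds = ∫ f(s) ds`; it is the inverse of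
the modular character of Mathlib. -/
def modularFunction (r : G) : ℝ≥0 := Measure.modularCharacter r⁻¹

theorem modularFunction_integral [MeasurableSpace G] [BorelSpace G] (μ : Measure G)
    [μ.IsHaarMeasure] (f : C_c(G, ℝ)) (r : G) :
    (modularFunction r : ℝ) * ∫ s, f (s * r) ∂μ = ∫ s, f s ∂μ := by
  have h := Measure.integral_isMulLeftInvariant_eq_smul_of_hasCompactSupport
    (Measure.map (· * r) μ) μ (map_continuous f) f.hasCompactSupport
  rw [integral_map (by fun_prop) (map_continuous f).aestronglyMeasurable,
    ← Measure.modularCharacterFun_eq_haarScalarFactor μ r, integral_smul_nnreal_measure] at h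
  have h1 : (modularFunction r : ℝ≥0) * Measure.modularCharacterFun r = 1 := by
    change Measure.modularCharacter r⁻¹ * Measure.modularCharacter r = 1
    rw [← map_mul, inv_mul_cancel, map_one]
  rw [h, NNReal.smul_def, smul_eq_mul, ← mul_assoc]
  have h2 : (modularFunction r : ℝ) * (Measure.modularCharacterFun r : ℝ) = 1 := by
    exact_mod_cast h1
  rw [h2, one_mul]

theorem continuous_modularCharacterFun :
    Continuous fun r : G => ((Measure.modularCharacterFun r : ℝ≥0) : ℝ) := by
  borelize G
  obtain ⟨⟨f, f_cont⟩, f_comp, f_nonneg, f_one⟩ :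
    ∃ f : C(G, ℝ), HasCompactSupport f ∧ 0 ≤ f ∧ f 1 ≠ 0 := exists_continuous_nonneg_pos 1
  let μ : Measure G := Measure.haar
  have hne : ∫ x, f x ∂μ ≠ 0 :=
    (f_cont.integral_pos_of_hasCompactSupport_nonneg_nonzero f_comp f_nonneg f_one).ne'
  have key : ∀ r : G, ((Measure.modularCharacterFun r : ℝ≥0) : ℝ) =
      (∫ x, f (x * r) ∂μ) / ∫ x, f x ∂μ := fun r => by
    rw [Measure.modularCharacterFun_eq_haarScalarFactor μ r,
      Measure.haarScalarFactor_eq_integral_div _ _ f_cont f_comp hne,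
      integral_map (by fun_prop) f_cont.aestronglyMeasurable]
  simp_rw [key]
  refine Continuous.div_const (continuous_iff_continuousAt.2 fun r₀ => ?_) _
  obtain ⟨t, t_comp, ht⟩ : ∃ t, IsCompact t ∧ t ∈ 𝓝 r₀ := exists_compact_mem_nhds r₀
  have hA : ContinuousOn (fun r : G => ∫ x, f (x * r) ∂μ) t := by
    apply continuousOn_integral_of_compact_support
      (f_comp.isCompact.mul t_comp.inv)
    · exact (f_cont.comp (continuous_snd.mul continuous_fst)).continuousOn
    · intro r x hr hx
      contrapose! hx
      exact ⟨x * r, subset_tsupport _ hx, r⁻¹, Set.inv_mem_inv.2 hr, by simp⟩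
  exact hA.continuousAt ht

/-- The involution `f*(s) = Δ(s⁻¹) conj(f(s⁻¹))` on `C_c(G)`. -/
def groupInvolution {𝕂 : Type*} [RCLike 𝕂] (f : C_c(G, 𝕂)) : C_c(G, 𝕂) where
  toFun := fun s => ((modularFunction s⁻¹ : ℝ) : 𝕂) * (starRingEnd 𝕂) (f s⁻¹)
  continuous_toFun := by
    have h : Continuous fun s : G => ((modularFunction s⁻¹ : ℝ≥0) : ℝ) := by
      have h' := continuous_modularCharacterFun (G := G)
      have : (fun s : G => ((modularFunction s⁻¹ : ℝ≥0) : ℝ)) =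
          fun s => ((Measure.modularCharacterFun s : ℝ≥0) : ℝ) := by
        funext s
        simp [modularFunction, Measure.modularCharacter]
      rwa [this]
    exact (RCLike.continuous_ofReal.comp h).mul
      (RCLike.continuous_conj.comp ((map_continuous f).comp continuous_inv))
  hasCompactSupport' := by
    refine HasCompactSupport.mul_left ?_
    refine HasCompactSupport.comp_left (g := starRingEnd 𝕂) ?_ (map_zero _)
    exact f.hasCompactSupport.comp_homeomorph (Homeomorph.inv G)

end Involution

end

universe u w v

/-! Write l_r f for `leftTranslate r f`. Three facts tie the group to the algebra: U(l_r f) = U_r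
U(f); normalised bumps u supported near the identity satisfy U(u)x → x; and the representations U^R
with U in R separate the points of the crossed product (`CrossedProduct.eq_of_induced_eq`), so
identities there can be tested in them. The first two let U^R recover each U_r on a dense set of
vectors U(f)x, which gives non-degeneracy, injectivity, and the passage of subspaces and
intertwiners from U^R back to U. The passage from U to U^R is integration followed by density of
C_c(G).

Surjectivity is the main point. Given T, the operator U_r has to send Σ T(f_i)x_i to Σ T(l_r
f_i)x_i. Such sums are dense, but it is not clear that this is well defined, let alone of norm at
most ν(r). `norm_translateEval_le` settles both: T(l_r u) applied to the first sum is the average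
against u(s) of the sums Σ T(l_{rs} f_i)x_i, so it is close to the second sum when u is concentrated
near the identity, while ‖T(l_r u)‖ ≤ ν(r)σ(u) ≤ ν(r)(1+ε) once ν ≤ 1+ε on the support of u. The
normalisation of ν at the identity enters only here, and ε → 0 gives the exact bound ν(r), which
puts U in R'.

In the unitary case the inversion formula for Haar measure makes U(f*) the adjoint of U(f). The star
identities then follow from uniqueness of adjoints, and the C*-inequality from ‖A‖² ≤ ‖A*A‖ in each
U. -/

noncomputable section

set_option linter.unusedSectionVars false

/-! ### Approximate identities, translates and inversion for Haar measure -/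

section HaarIntegration

open scoped Pointwise

variable {G : Type*} [Group G] [TopologicalSpace G] [IsTopologicalGroup G] [LocallyCompactSpace G]
  [MeasurableSpace G] [BorelSpace G] {𝕂 : Type*} [RCLike 𝕂]
  {E : Type*} [NormedAddCommGroup E] [NormedSpace ℝ E] [NormedSpace 𝕂 E]
  [CompleteSpace E] [IsScalarTower ℝ 𝕂 E] [SMulCommClass ℝ 𝕂 E]

/-- A Urysohn function divided by its integral. Being non-negative, it has total mass and L¹-norm
both equal to 1: the first reproduces constants, the second controls norms. -/
theorem exists_normalized_bump (𝕂 : Type*) [RCLike 𝕂] [T2Space G] (μ : Measure G)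
    [μ.IsHaarMeasure] {V : Set G} (hV : V ∈ 𝓝 (1 : G)) :
    ∃ u : C_c(G, 𝕂), tsupport u ⊆ V ∧ ∫ s, ‖u s‖ ∂μ = 1 ∧ ∫ s, u s ∂μ = 1 := by
  obtain ⟨f, hf1, hfc, hfV, hf01⟩ := exists_continuousMap_one_of_isCompact_subset_isOpen
    (isCompact_singleton (x := (1 : G))) isOpen_interior
    (Set.singleton_subset_iff.2 (mem_interior_iff_mem_nhds.2 hV))
  have hpos : 0 < ∫ s, f s ∂μ :=
    f.continuous.integral_pos_of_hasCompactSupport_nonneg_nonzero hfc (fun s => (hf01 s).1)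
      (x := 1) (by simp [hf1 rfl])
  set c : ℝ := (∫ s, f s ∂μ)⁻¹ with hc
  have hc0 : 0 < c := inv_pos.2 hpos
  let u : C_c(G, 𝕂) :=
    { toFun := fun s => ((c * f s : ℝ) : 𝕂)
      continuous_toFun := by fun_prop
      hasCompactSupport' :=
        HasCompactSupport.comp_left (g := fun t : ℝ => ((c * t : ℝ) : 𝕂)) hfc (by simp) }
  have hu : ∀ s, u s = ((c * f s : ℝ) : 𝕂) := fun s => rfl
  refine ⟨u, ?_, ?_, ?_⟩
  · refine (closure_mono fun s hs => ?_).trans (hfV.trans interior_subset)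
    intro h0
    exact hs (by simp [hu, h0])
  · have : ∀ s, ‖u s‖ = c * f s := fun s => by
      rw [hu, RCLike.norm_ofReal, abs_of_nonneg (mul_nonneg hc0.le (hf01 s).1)]
    simp only [this, integral_const_mul, hc]
    exact inv_mul_cancel₀ hpos.ne'
  · simp only [hu]
    rw [integral_ofReal, integral_const_mul, hc, inv_mul_cancel₀ hpos.ne', RCLike.ofReal_one]

theorem CompactlySupportedContinuousMap.integrable_smul (μ : Measure G)
    [IsFiniteMeasureOnCompacts μ] (f : C_c(G, 𝕂)) {φ : G → E} (hφ : Continuous φ) :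
    Integrable (fun s => f s • φ s) μ :=
  ((map_continuous f).smul hφ).integrable_of_hasCompactSupport f.hasCompactSupport.smul_right

theorem norm_integral_smul_sub_le {μ : Measure G} [IsFiniteMeasureOnCompacts μ] {u : C_c(G, 𝕂)}
    (hu1 : ∫ s, ‖u s‖ ∂μ = 1) (hu2 : ∫ s, u s ∂μ = 1) {φ : G → E} (hφ : Continuous φ) (c : E)
    {ε : ℝ} (h : ∀ s ∈ tsupport u, ‖φ s - c‖ ≤ ε) : ‖(∫ s, u s • φ s ∂μ) - c‖ ≤ ε := by
  have hi := CompactlySupportedContinuousMap.integrable_smul μ u hφ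
  have hu : Integrable (fun s => ‖u s‖) μ :=
    ((map_continuous u).integrable_of_hasCompactSupport u.hasCompactSupport).norm
  have hc : c = ∫ s, u s • c ∂μ := by rw [integral_smul_const, hu2, one_smul]
  calc ‖(∫ s, u s • φ s ∂μ) - c‖ = ‖∫ s, u s • (φ s - c) ∂μ‖ := by
        conv_lhs => rw [hc]
        rw [← integral_sub hi (CompactlySupportedContinuousMap.integrable_smul μ u
          continuous_const)]
        simp only [smul_sub]
    _ ≤ ∫ s, ‖u s • (φ s - c)‖ ∂μ := norm_integral_le_integral_norm _
    _ ≤ ∫ s, ε * ‖u s‖ ∂μ := by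
        refine integral_mono (CompactlySupportedContinuousMap.integrable_smul μ u
          (hφ.sub continuous_const)).norm (hu.const_mul _) fun s => ?_
        by_cases hs : s ∈ tsupport u
        · simp only [norm_smul]
          rw [mul_comm]
          gcongr
          exact h s hs
        · simp [image_eq_zero_of_notMem_tsupport hs]
    _ = ε := by rw [integral_const_mul, hu1, mul_one]

/-- The left translate `s ↦ f (r⁻¹ s)`. -/
def leftTranslate (r : G) (f : C_c(G, 𝕂)) : C_c(G, 𝕂) where
  toFun := fun s => f (r⁻¹ * s)
  continuous_toFun := (map_continuous f).comp (continuous_const.mul continuous_id)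
  hasCompactSupport' := f.hasCompactSupport.comp_homeomorph (Homeomorph.mulLeft r⁻¹)

theorem leftTranslate_apply (r s : G) (f : C_c(G, 𝕂)) : leftTranslate r f s = f (r⁻¹ * s) := rfl

theorem leftTranslate_one (f : C_c(G, 𝕂)) : leftTranslate 1 f = f := by
  ext s
  simp [leftTranslate_apply]

theorem leftTranslate_mul (r s : G) (f : C_c(G, 𝕂)) :
    leftTranslate (r * s) f = leftTranslate r (leftTranslate s f) := by
  ext t
  simp [leftTranslate_apply, mul_assoc]

theorem StrongContRep.integrate_leftTranslate {X : BanachSp 𝕂} (μ : Measure G) [μ.IsHaarMeasure]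
    (U : StrongContRep G X) (r : G) (f : C_c(G, 𝕂)) (x : X) :
    U.integrate μ (leftTranslate r f) x = U.op r (U.integrate μ f x) := by
  rw [U.integrate_apply μ (leftTranslate r f), U.integrate_apply μ f,
    ← ContinuousLinearMap.integral_comp_comm _ (U.integrable μ f x),
    ← integral_mul_left_eq_self _ r]
  simp [leftTranslate_apply, U.op_mul]

/-- The compact set does not depend on r and t in K, so one bound for ν serves all these
differences. -/
theorem tsupport_leftTranslate_sub_subset [T2Space G] {K : Set G} (hK : IsCompact K) {r t : G}
    (hr : r ∈ K) (ht : t ∈ K) (f : C_c(G, 𝕂)) :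
    tsupport (leftTranslate r f - leftTranslate t f) ⊆ K * tsupport f := by
  refine closure_minimal (fun s hs => ?_) (hK.mul f.hasCompactSupport.isCompact).isClosed
  by_contra hs'
  have key : ∀ r ∈ K, f (r⁻¹ * s) = 0 := fun r hr => image_eq_zero_of_notMem_tsupport fun h =>
    hs' ⟨r, hr, r⁻¹ * s, h, by simp⟩
  exact hs (by simp [leftTranslate_apply, key r hr, key t ht])

theorem integral_norm_sub_leftTranslate_continuousAt [T2Space G] (μ : Measure G) [μ.IsHaarMeasure]
    (f : C_c(G, 𝕂)) (r₀ : G) :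
    ContinuousAt (fun r => ∫ s, ‖(leftTranslate r f - leftTranslate r₀ f) s‖ ∂μ) r₀ := by
  obtain ⟨K, hK, hKr⟩ := exists_compact_mem_nhds r₀
  refine ContinuousOn.continuousAt (s := K) ?_ hKr
  refine continuousOn_integral_of_compact_support (k := K * tsupport f)
    (hK.mul f.hasCompactSupport.isCompact) ?_ fun r s hr hs => ?_
  · refine Continuous.continuousOn (Continuous.norm ?_)
    exact ((map_continuous f).comp (continuous_fst.inv.mul continuous_snd)).sub
      ((map_continuous f).comp (continuous_const.mul continuous_snd))
  · rw [image_eq_zero_of_notMem_tsupport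
      fun h => hs (tsupport_leftTranslate_sub_subset hK hr (mem_of_mem_nhds hKr) f h), norm_zero]

theorem continuous_modularFunction : Continuous fun r : G => ((modularFunction r : ℝ≥0) : ℝ) :=
  continuous_modularCharacterFun.comp continuous_inv

/-- The inversion formula for Haar measure: `∫ Δ(s⁻¹) φ(s⁻¹) ds = ∫ φ(s) ds`. -/
theorem integral_modularFunction_smul_inv (μ : Measure G) [μ.IsHaarMeasure] {φ : G → E}
    (hφ : Continuous φ) (hφc : HasCompactSupport φ) :
    ∫ s, (modularFunction s⁻¹ : ℝ) • φ s⁻¹ ∂μ = ∫ s, φ s ∂μ := by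
  obtain ⟨ψ₀, hψc, hψ0, hψ1⟩ := exists_continuous_nonneg_pos (1 : G)
  let ψ : C_c(G, ℝ) := ⟨ψ₀, hψc⟩
  have hψ : ∫ t, ψ t ∂μ ≠ 0 :=
    (ψ₀.continuous.integral_pos_of_hasCompactSupport_nonneg_nonzero hψc hψ0 hψ1).ne'
  have hψcont : Continuous ψ := map_continuous ψ
  set θ : G → E := fun s => (modularFunction s : ℝ) • φ s with hθ
  have hθcont : Continuous θ := continuous_modularFunction.smul hφ
  have hθ0 : ∀ s ∉ tsupport φ, θ s = 0 := fun s hs => by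
    simp [hθ, image_eq_zero_of_notMem_tsupport hs]
  have hψz : ∀ s ∉ tsupport ψ, ψ s = 0 := fun s hs => image_eq_zero_of_notMem_tsupport hs
  -- Multiply by ∫ ψ ≠ 0 and compute a double integral. Left invariance and two uses of Fubini lead
  -- to ∫∫ ψ(st) Δ(t) φ(t) ds dt, where the normalisation of Δ replaces Δ(t) ∫ ψ(st) ds by ∫ ψ.
  refine smul_right_injective E hψ ?_
  change (∫ t, ψ t ∂μ) • ∫ s, θ s⁻¹ ∂μ = (∫ t, ψ t ∂μ) • ∫ s, φ s ∂μ
  calc (∫ t, ψ t ∂μ) • ∫ s, θ s⁻¹ ∂μ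
      = ∫ t, ψ t • ∫ s, θ s⁻¹ ∂μ ∂μ := (integral_smul_const _ _).symm
    _ = ∫ t, ∫ s, ψ t • θ (s⁻¹ * t) ∂μ ∂μ := by
        congr 1 with t
        rw [← integral_smul, ← integral_mul_left_eq_self _ t⁻¹]
        simp
    _ = ∫ s, ∫ t, ψ t • θ (s⁻¹ * t) ∂μ ∂μ := by
        apply integral_integral_swap_of_hasCompactSupport
        · exact (hψcont.comp continuous_fst).smul
            (hθcont.comp (continuous_snd.inv.mul continuous_fst))
        · refine HasCompactSupport.intro (K := tsupport ψ ×ˢ (tsupport ψ * (tsupport φ)⁻¹))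
            (hψc.isCompact.prod (hψc.isCompact.mul hφc.isCompact.inv)) ?_
          rintro ⟨t, s⟩ h
          by_cases ht : t ∈ tsupport ψ
          · have : s⁻¹ * t ∉ tsupport φ := fun h' =>
              h ⟨ht, t, ht, (s⁻¹ * t)⁻¹, Set.inv_mem_inv.2 h', by simp⟩
            simp [Function.uncurry, hθ0 _ this]
          · simp [Function.uncurry, hψz t ht]
    _ = ∫ s, ∫ t, ψ (s * t) • θ t ∂μ ∂μ := by
        congr 1 with s
        rw [← integral_mul_left_eq_self _ s]
        simp
    _ = ∫ t, ∫ s, ψ (s * t) • θ t ∂μ ∂μ := by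
        apply integral_integral_swap_of_hasCompactSupport
        · exact (hψcont.comp (continuous_fst.mul continuous_snd)).smul
            (hθcont.comp continuous_snd)
        · refine HasCompactSupport.intro (K := (tsupport ψ * (tsupport φ)⁻¹) ×ˢ tsupport φ)
            ((hψc.isCompact.mul hφc.isCompact.inv).prod hφc.isCompact) ?_
          rintro ⟨s, t⟩ h
          by_cases ht : t ∈ tsupport φ
          · have : s * t ∉ tsupport ψ := fun h' =>
              h ⟨⟨s * t, h', t⁻¹, Set.inv_mem_inv.2 ht, by simp⟩, ht⟩
            simp [Function.uncurry, hψz _ this]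
          · simp [Function.uncurry, hθ0 t ht]
    _ = ∫ t, (∫ s, ψ s ∂μ) • φ t ∂μ := by
        congr 1 with t
        rw [integral_smul_const, ← modularFunction_integral μ ψ t, hθ, smul_smul, mul_comm]
    _ = (∫ t, ψ t ∂μ) • ∫ s, φ s ∂μ := integral_smul _ _

end HaarIntegration

/-! ### Density, separation and translation in the crossed product -/

section CrossedProductRepresentations

open scoped Pointwise

variable {G : Type*} [Group G] [TopologicalSpace G] [IsTopologicalGroup G] [LocallyCompactSpace G]
  [MeasurableSpace G] [BorelSpace G] {𝕂 : Type*} [RCLike 𝕂] {X Y : BanachSp 𝕂}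
  (μ : Measure G) [μ.IsHaarMeasure] {R : Set (SomeRep G 𝕂)} (hR : UniformlyBoundedClass R)

/-- The canonical map from `C_c(G)` into the crossed product, as a linear map. -/
def CrossedProduct.ofCc : C_c(G, 𝕂) →ₗ[𝕂] CrossedProduct μ R hR where
  toFun := fun f => CrossedProduct.q μ R hR f
  map_add' := map_add (CrossedProduct.q μ R hR)
  map_smul' := map_smul (CrossedProduct.q μ R hR)

theorem CrossedProduct.denseRange_ofCc : DenseRange (CrossedProduct.ofCc μ hR) :=
  CrossedProduct.denseRange_q μ R hR

theorem CrossedProduct.norm_ofCc (f : C_c(G, 𝕂)) :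
    ‖CrossedProduct.ofCc μ hR f‖ = classSeminorm μ R f :=
  CrossedProduct.norm_q μ R hR f

theorem CrossedProduct.ofCc_mul_ofCc (f g : C_c(G, 𝕂)) :
    CrossedProduct.ofCc μ hR f * CrossedProduct.ofCc μ hR g =
      CrossedProduct.ofCc μ hR (groupConvolution μ f g) :=
  (NonUnitalAlgHom.map_mul (CrossedProduct.q μ R hR) f g).symm

theorem StrongContRep.induced_ofCc {U : StrongContRep G X} (hU : U.ContinuousFor μ R)
    (f : C_c(G, 𝕂)) : U.induced μ hR hU (CrossedProduct.ofCc μ hR f) = U.integrate μ f :=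
  U.induced_q μ hR hU f

/-- Bumps concentrated where U_s x is close to x do this. The approximants use the same vector x,
which is stronger than density of a span and is what invariant subspaces require. -/
theorem StrongContRep.mem_closure_range_integrate [T2Space G] (U : StrongContRep G X) (x : X) :
    x ∈ closure (Set.range fun f : C_c(G, 𝕂) => U.integrate μ f x) := by
  refine Metric.mem_closure_range_iff.2 fun ε hε => ?_
  have hV : {s | ‖U.op s x - x‖ < ε / 2} ∈ 𝓝 (1 : G) := by
    have hc : Continuous fun s => ‖U.op s x - x‖ := ((U.continuous_op x).sub continuous_const).norm
    refine hc.continuousAt.eventually_lt continuousAt_const ?_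
    simpa [StrongContRep.op] using half_pos hε
  obtain ⟨u, huV, hu1, hu2⟩ := exists_normalized_bump 𝕂 μ hV
  refine ⟨u, ?_⟩
  rw [dist_comm, dist_eq_norm]
  exact (norm_integral_smul_sub_le hu1 hu2 (U.continuous_op x) x
    fun s hs => (huV hs).le).trans_lt (half_lt_self hε)

theorem StrongContRep.dense_span_integrate [T2Space G] (U : StrongContRep G X) :
    Dense (Submodule.span 𝕂 {y : X | ∃ (f : C_c(G, 𝕂)) (x : X), y = U.integrate μ f x} : Set X) :=
  fun x => closure_mono (by
    rintro _ ⟨f, rfl⟩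
    exact Submodule.subset_span ⟨f, x, rfl⟩) (U.mem_closure_range_integrate μ x)

theorem StrongContRep.continuous_induced {U : StrongContRep G X} (hU : U.ContinuousFor μ R) :
    Continuous (U.induced μ hR hU) :=
  (U.inducedMap μ hR).continuous

theorem StrongContRep.norm_induced_le {U : SomeRep G 𝕂} (hU : U ∈ R)
    (a : CrossedProduct μ R hR) :
    ‖U.2.induced μ hR (continuousFor_of_mem μ hR hU) a‖ ≤ ‖a‖ := by
  refine (CrossedProduct.denseRange_ofCc μ hR).induction_on (p := fun a =>
    ‖U.2.induced μ hR (continuousFor_of_mem μ hR hU) a‖ ≤ ‖a‖) a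
    (isClosed_le (StrongContRep.continuous_induced μ hR _).norm continuous_norm) fun f => ?_
  rw [StrongContRep.induced_ofCc, CrossedProduct.norm_ofCc]
  exact norm_integrate_le_classSeminorm μ hR hU f

theorem CrossedProduct.norm_ofCc_le {f : C_c(G, 𝕂)} {c : ℝ} (hc : 0 ≤ c)
    (h : ∀ U ∈ R, ‖U.2.integrate μ f‖ ≤ c) : ‖CrossedProduct.ofCc μ hR f‖ ≤ c := by
  rw [CrossedProduct.norm_ofCc]
  exact Real.iSup_le (fun U => h U.1 U.2) hc

/-- The norm on C_c(G) is a supremum over R. If f approximates a − b, on which every U^R vanishes,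
then all ‖U(f)‖ are small, hence so is f and with it a − b. -/
theorem CrossedProduct.eq_of_induced_eq {a b : CrossedProduct μ R hR}
    (h : ∀ U : SomeRep G 𝕂, ∀ hU : U ∈ R, U.2.induced μ hR (continuousFor_of_mem μ hR hU) a =
      U.2.induced μ hR (continuousFor_of_mem μ hR hU) b) : a = b := by
  rw [← sub_eq_zero, ← norm_eq_zero]
  refine le_antisymm (le_of_forall_pos_le_add fun ε hε => ?_) (norm_nonneg _)
  obtain ⟨f, hf⟩ := (CrossedProduct.denseRange_ofCc μ hR).exists_dist_lt (a - b) (half_pos hε)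
  rw [dist_eq_norm] at hf
  have hq : ‖CrossedProduct.ofCc μ hR f‖ ≤ ε / 2 :=
    CrossedProduct.norm_ofCc_le μ hR (half_pos hε).le fun U hU => by
      have h1 := StrongContRep.norm_induced_le μ hR hU (a - b - CrossedProduct.ofCc μ hR f)
      rw [map_sub, map_sub, h U hU, sub_self, zero_sub, norm_neg, StrongContRep.induced_ofCc] at h1
      exact h1.trans hf.le
  have := norm_add_le (a - b - CrossedProduct.ofCc μ hR f) (CrossedProduct.ofCc μ hR f)
  rw [sub_add_cancel] at this
  linarith

theorem CrossedProduct.ofCc_eq_of_integrate_eq {f g : C_c(G, 𝕂)}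
    (h : ∀ U ∈ R, U.2.integrate μ f = U.2.integrate μ g) :
    CrossedProduct.ofCc μ hR f = CrossedProduct.ofCc μ hR g :=
  CrossedProduct.eq_of_induced_eq μ hR fun U hU => by
    rw [StrongContRep.induced_ofCc, StrongContRep.induced_ofCc]
    exact h U hU

theorem CrossedProduct.norm_ofCc_leftTranslate_le {r : G} {c : ℝ} (hc : 0 ≤ c)
    (h : ∀ U ∈ R, ‖U.2.op r‖ ≤ c) (f : C_c(G, 𝕂)) :
    ‖CrossedProduct.ofCc μ hR (leftTranslate r f)‖ ≤ c * ‖CrossedProduct.ofCc μ hR f‖ := by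
  refine CrossedProduct.norm_ofCc_le μ hR (by positivity) fun U hU => ?_
  have h1 : U.2.integrate μ (leftTranslate r f) = (U.2.op r).comp (U.2.integrate μ f) :=
    ContinuousLinearMap.ext fun x => U.2.integrate_leftTranslate μ r f x
  rw [h1, CrossedProduct.norm_ofCc]
  exact (ContinuousLinearMap.opNorm_comp_le _ _).trans (mul_le_mul (h U hU)
    (norm_integrate_le_classSeminorm μ hR hU f) (norm_nonneg _) hc)

/-- For r near r₀ the differences of translates live in one compact set, where the representations
in R share a bound M. The seminorm is therefore at most M times the L¹-distance, which tends to 0.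
-/
theorem CrossedProduct.continuous_ofCc_leftTranslate [T2Space G] (f : C_c(G, 𝕂)) :
    Continuous fun r => CrossedProduct.ofCc μ hR (leftTranslate r f) := by
  refine continuous_iff_continuousAt.2 fun r₀ => ?_
  obtain ⟨K, hK, hKr⟩ := exists_compact_mem_nhds r₀
  obtain ⟨ν, hν, hU⟩ := id hR
  obtain ⟨M, hM⟩ := hν _ (hK.mul f.hasCompactSupport.isCompact)
  have hI := integral_norm_sub_leftTranslate_continuousAt μ f r₀
  have hlim : Filter.Tendsto
      (fun r => (M : ℝ) * ∫ s, ‖(leftTranslate r f - leftTranslate r₀ f) s‖ ∂μ) (𝓝 r₀) (𝓝 0) := by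
    have := (hI.tendsto).const_mul (M : ℝ)
    simpa using this
  refine tendsto_iff_norm_sub_tendsto_zero.2 (squeeze_zero' (Filter.Eventually.of_forall
    fun r => norm_nonneg _) ?_ hlim)
  filter_upwards [hKr] with r hr
  rw [← map_sub]
  refine CrossedProduct.norm_ofCc_le μ hR (by positivity) fun U hU' => ?_
  refine U.2.norm_integrate_le μ _ M.2 fun s hs => (hU U hU' s).trans ?_
  exact NNReal.coe_le_coe.2
    (hM ⟨s, tsupport_leftTranslate_sub_subset hK hr (mem_of_mem_nhds hKr) f hs, rfl⟩)

instance CrossedProduct.instRealNormedSpace : NormedSpace ℝ (CrossedProduct μ R hR) :=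
  NormedSpace.restrictScalars ℝ 𝕂 _

instance CrossedProduct.instRealScalarTower : IsScalarTower ℝ 𝕂 (CrossedProduct μ R hR) :=
  IsScalarTower.restrictScalars ℝ 𝕂 _

instance CrossedProduct.instRealSMulComm : SMulCommClass ℝ 𝕂 (CrossedProduct μ R hR) :=
  ⟨fun a b x => by
    change (algebraMap ℝ 𝕂 a) • b • x = b • (algebraMap ℝ 𝕂 a) • x
    rw [smul_comm]⟩

/-- The product in the crossed product is an integral of translates. -/
theorem CrossedProduct.integral_smul_ofCc_leftTranslate [T2Space G] (f g : C_c(G, 𝕂)) :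
    ∫ s, f s • CrossedProduct.ofCc μ hR (leftTranslate s g) ∂μ =
      CrossedProduct.ofCc μ hR f * CrossedProduct.ofCc μ hR g := by
  -- In each U, evaluation at x is bounded and passes inside the integral; there U(l_s g)x = U_s
  -- U(g)x, so the integral becomes U(f)U(g)x.
  refine CrossedProduct.eq_of_induced_eq μ hR fun U hU => ?_
  rw [map_mul, StrongContRep.induced_ofCc, StrongContRep.induced_ofCc]
  ext x
  change (ContinuousLinearMap.apply 𝕂 U.1 x).comp (U.2.inducedMap μ hR) _ =
    U.2.integrate μ f (U.2.integrate μ g x)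
  rw [← ContinuousLinearMap.integral_comp_comm _
    (CompactlySupportedContinuousMap.integrable_smul μ f
      (CrossedProduct.continuous_ofCc_leftTranslate μ hR g)), U.2.integrate_apply μ f]
  congr 1 with s
  change U.2.inducedMap μ hR (f s • _) x = _
  rw [map_smul, ← U.2.integrate_leftTranslate μ]
  exact congrArg (fun S => f s • S x)
    (StrongContRep.induced_ofCc μ hR (continuousFor_of_mem μ hR hU) _)

/-! ### Invariant subspaces and intertwining operators -/

theorem StrongContRep.isNondegenerateRep_induced [T2Space G] {U : StrongContRep G X}
    (hU : U.ContinuousFor μ R) : IsNondegenerateRep (U.induced μ hR hU) :=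
  (U.dense_span_integrate μ).mono (Submodule.span_mono (by
    rintro _ ⟨f, x, rfl⟩
    exact ⟨CrossedProduct.ofCc μ hR f, x, by rw [StrongContRep.induced_ofCc]⟩))

/-- Forwards, Φ commutes with the integral and C_c(G) is dense. Backwards, on the total set of
vectors U(f)x one has V_r Φ U(f)x = V(l_r f)Φx = Φ U(l_r f)x = Φ U_r U(f)x. -/
theorem StrongContRep.intertwines_induced_iff [T2Space G] {U : StrongContRep G X}
    {V : StrongContRep G Y} (hU : U.ContinuousFor μ R) (hV : V.ContinuousFor μ R) (Φ : X →L[𝕂] Y) :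
    Intertwines (fun r : G => U.op r) (fun r : G => V.op r) Φ ↔
      Intertwines (fun a : CrossedProduct μ R hR => U.induced μ hR hU a)
        (fun a : CrossedProduct μ R hR => V.induced μ hR hV a) Φ := by
  constructor
  · intro h a
    refine (CrossedProduct.denseRange_ofCc μ hR).induction_on (p := fun a =>
      (V.induced μ hR hV a).comp Φ = Φ.comp (U.induced μ hR hU a)) a
      (isClosed_eq ((StrongContRep.continuous_induced μ hR hV).clm_comp continuous_const)
        (continuous_const.clm_comp (StrongContRep.continuous_induced μ hR hU))) fun f => ?_
    rw [StrongContRep.induced_ofCc, StrongContRep.induced_ofCc]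
    ext x
    change ∫ s, f s • V.op s (Φ x) ∂μ = Φ (∫ s, f s • U.op s x ∂μ)
    rw [← ContinuousLinearMap.integral_comp_comm _ (U.integrable μ f x)]
    congr 1 with s
    rw [map_smul]
    congr 1
    exact DFunLike.congr_fun (h s) x
  · intro h r
    have h' : ∀ (f : C_c(G, 𝕂)) (x : X), V.integrate μ f (Φ x) = Φ (U.integrate μ f x) :=
      fun f x => by
        have := DFunLike.congr_fun (h (CrossedProduct.ofCc μ hR f)) x
        simp only [StrongContRep.induced_ofCc] at this
        exact this
    refine ContinuousLinearMap.ext_on (U.dense_span_integrate μ) ?_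
    rintro _ ⟨f, x, rfl⟩
    change V.op r (Φ (U.integrate μ f x)) = Φ (U.op r (U.integrate μ f x))
    rw [← U.integrate_leftTranslate μ, ← h', ← h', V.integrate_leftTranslate μ]

theorem StrongContRep.ext_op {U V : StrongContRep G X} (h : ∀ r, U.op r = V.op r) : U = V := by
  cases U
  cases V
  congr 1
  ext r : 2
  exact h r

/-- The identity operator intertwines U^R and V^R, hence U and V. -/
theorem StrongContRep.eq_of_induced_eq [T2Space G] {U V : StrongContRep G X}
    (hU : U.ContinuousFor μ R) (hV : V.ContinuousFor μ R)
    (h : U.induced μ hR hU = V.induced μ hR hV) : U = V := by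
  refine StrongContRep.ext_op fun r => ?_
  have := (StrongContRep.intertwines_induced_iff μ hR hU hV (ContinuousLinearMap.id 𝕂 X)).2
    (fun a => by simp [h]) r
  simpa using this.symm

theorem StrongContRep.integrate_mem (U : StrongContRep G X) {Z : Submodule 𝕂 X}
    (hZ : IsClosed (Z : Set X)) (h : IsInvariantUnder (fun r : G => U.op r) Z) (f : C_c(G, 𝕂))
    {x : X} (hx : x ∈ Z) : U.integrate μ f x ∈ Z := by
  -- A closed subspace is complete, so the integral can be formed inside Z.
  have : CompleteSpace Z := hZ.completeSpace_coe
  have := Z.subtypeₗᵢ.integral_comp_comm (μ := μ)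
    fun s => (⟨f s • U.op s x, Z.smul_mem _ (h s x hx)⟩ : Z)
  rw [U.integrate_apply μ]
  exact this ▸ Subtype.property _

theorem StrongContRep.isInvariantUnder_induced_iff [T2Space G] {U : StrongContRep G X}
    (hU : U.ContinuousFor μ R) {Z : Submodule 𝕂 X} (hZ : IsClosed (Z : Set X)) :
    IsInvariantUnder (fun r : G => U.op r) Z ↔
      IsInvariantUnder (fun a : CrossedProduct μ R hR => U.induced μ hR hU a) Z := by
  constructor
  · intro h a x hx
    refine (CrossedProduct.denseRange_ofCc μ hR).induction_on (p := fun a =>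
      U.induced μ hR hU a x ∈ Z) a (hZ.preimage ((StrongContRep.continuous_induced μ hR hU).clm_apply
        continuous_const)) fun f => ?_
    rw [StrongContRep.induced_ofCc]
    exact U.integrate_mem μ hZ h f hx
  · intro h r x hx
    -- U_r x is a limit of vectors U_r U(f)x = U(l_r f)x, which lie in Z.
    have hm := map_mem_closure (U.op r).continuous (U.mem_closure_range_integrate μ x)
      (t := (Z : Set X)) (by
        rintro _ ⟨f, rfl⟩
        have := h (CrossedProduct.ofCc μ hR (leftTranslate r f)) x hx
        simp only [StrongContRep.induced_ofCc] at this
        rwa [U.integrate_leftTranslate μ] at this)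
    rwa [hZ.closure_eq] at hm

end CrossedProductRepresentations

/-! ### Recovering the group representation from a representation of the algebra -/

section GroupRepOfAlgebraRep

open scoped Pointwise

variable {G : Type*} [Group G] [TopologicalSpace G] [IsTopologicalGroup G] [LocallyCompactSpace G]
  [MeasurableSpace G] [BorelSpace G] {𝕂 : Type*} [RCLike 𝕂] {X : BanachSp 𝕂}
  (μ : Measure G) [μ.IsHaarMeasure] {R : Set (SomeRep G 𝕂)} {hR : UniformlyBoundedClass R}
  (T : CrossedProduct μ R hR →ₙₐ[𝕂] (X →L[𝕂] X))

theorem exists_nhds_le_one_add {𝓩 : Set (Set G)}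
    (h𝓩 : (𝓝 (1 : G)).HasBasis (fun V : Set G => V ∈ 𝓩) id) {K₀ : Set G} (hK₀ : IsCompact K₀)
    (h𝓩K₀ : ∀ V ∈ 𝓩, V ⊆ K₀) {ν : G → ℝ≥0} (hν : ∀ K : Set G, IsCompact K → BddAbove (ν '' K))
    (hν1 : (⨅ V : 𝓩, ⨆ r : (V : Set G), ν r) = 1) {ε : ℝ} (hε : 0 < ε) :
    ∃ V ∈ 𝓝 (1 : G), ∀ r ∈ V, (ν r : ℝ) ≤ 1 + ε := by
  obtain ⟨V₀, hV₀, -⟩ := h𝓩.mem_iff.1 Filter.univ_mem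
  have : Nonempty 𝓩 := ⟨⟨V₀, hV₀⟩⟩
  have hlt : (⨅ V : 𝓩, ⨆ r : (V : Set G), ν r) < 1 + ε.toNNReal := by
    rw [hν1]
    exact lt_add_of_pos_right _ (Real.toNNReal_pos.2 hε)
  obtain ⟨V, hV⟩ := exists_lt_of_ciInf_lt hlt
  refine ⟨V, h𝓩.mem_of_mem V.2, fun r hr => ?_⟩
  -- An unbounded supremum in ℝ≥0 is 0 by convention and would bound nothing; the compact set K₀
  -- excludes this.
  have hb : BddAbove (Set.range fun r : (V : Set G) => ν r) := by
    refine (hν K₀ hK₀).mono ?_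
    rintro _ ⟨r, rfl⟩
    exact ⟨r, h𝓩K₀ V V.2 r.2, rfl⟩
  have h1 : ν r < 1 + ε.toNNReal := (le_ciSup hb ⟨r, hr⟩).trans_lt hV
  have h2 : (ν r : ℝ) < 1 + (ε.toNNReal : ℝ) := by exact_mod_cast h1
  rw [Real.coe_toNNReal _ hε.le] at h2
  exact h2.le

/-- Formal sums of symbols `T(f)x`, evaluated after translating all functions by `r`. -/
def translateEval (r : G) : (C_c(G, 𝕂) × X →₀ 𝕂) →ₗ[𝕂] X :=
  Finsupp.linearCombination 𝕂 fun p : C_c(G, 𝕂) × X =>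
    T (CrossedProduct.ofCc μ hR (leftTranslate r p.1)) p.2

theorem translateEval_single (r : G) (f : C_c(G, 𝕂)) (x : X) (c : 𝕂) :
    translateEval μ T r (Finsupp.single (f, x) c) =
      c • T (CrossedProduct.ofCc μ hR (leftTranslate r f)) x :=
  Finsupp.linearCombination_single ..

variable {T}

theorem IsContractiveRep.continuous (hT : IsContractiveRep T) : Continuous T :=
  (LinearMap.mkContinuous (T : CrossedProduct μ R hR →ₗ[𝕂] (X →L[𝕂] X)) 1 fun a => by
    rw [one_mul]
    exact hT a).continuous

theorem continuous_translateEval [T2Space G] (hT : IsContractiveRep T)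
    (w : C_c(G, 𝕂) × X →₀ 𝕂) : Continuous fun r => translateEval μ T r w := by
  induction w using Finsupp.induction_linear with
  | zero => simpa using continuous_const
  | add v w hv hw =>
    simp only [map_add]
    exact hv.add hw
  | single p c =>
    obtain ⟨f, x⟩ := p
    simp only [translateEval_single]
    exact (((hT.continuous μ).comp (CrossedProduct.continuous_ofCc_leftTranslate μ hR f)).clm_apply
      continuous_const).const_smul c

/-- Apply T to the formula for a product as an integral of translates. This says that T(h) is
already an integrated form on the dense set of sums, before any U_s has been constructed. -/
theorem apply_translateEval_one [T2Space G] (hT : IsContractiveRep T) (h : C_c(G, 𝕂))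
    (w : C_c(G, 𝕂) × X →₀ 𝕂) :
    T (CrossedProduct.ofCc μ hR h) (translateEval μ T 1 w) =
      ∫ s, h s • translateEval μ T s w ∂μ := by
  induction w using Finsupp.induction_linear with
  | zero => simp
  | add v w hv hw =>
    simp only [map_add, smul_add, hv, hw]
    exact (integral_add
      (CompactlySupportedContinuousMap.integrable_smul μ h (continuous_translateEval μ hT v))
      (CompactlySupportedContinuousMap.integrable_smul μ h
        (continuous_translateEval μ hT w))).symm
  | single p c =>
    obtain ⟨f, x⟩ := p
    simp only [translateEval_single, leftTranslate_one, map_smul, smul_comm _ c]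
    rw [integral_smul]
    congr 1
    change (T (CrossedProduct.ofCc μ hR h) * T (CrossedProduct.ofCc μ hR f)) x = _
    rw [← map_mul, ← CrossedProduct.integral_smul_ofCc_leftTranslate]
    let L : CrossedProduct μ R hR →L[𝕂] X := (ContinuousLinearMap.apply 𝕂 X x).comp
      ⟨(T : CrossedProduct μ R hR →ₗ[𝕂] (X →L[𝕂] X)), hT.continuous μ⟩
    change L _ = _
    rw [← ContinuousLinearMap.integral_comp_comm _
      (CompactlySupportedContinuousMap.integrable_smul μ h
        (CrossedProduct.continuous_ofCc_leftTranslate μ hR f))]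
    simp only [map_smul]
    rfl

theorem denseRange_translateEval_one (hT : IsContractiveRep T) (hnd : IsNondegenerateRep T) :
    DenseRange (translateEval μ T 1) := by
  refine Dense.of_closure (hnd.mono ?_)
  have hcl : closure (Set.range (translateEval μ T 1)) =
      ((LinearMap.range (translateEval μ T 1)).topologicalClosure : Set X) := by
    rw [Submodule.topologicalClosure_coe, LinearMap.coe_range]
  -- The closure of the range is a submodule, so only the generators T(a)x need to be approximated.
  rw [hcl, SetLike.coe_subset_coe, Submodule.span_le, ← hcl]
  rintro _ ⟨a, x, rfl⟩
  refine (CrossedProduct.denseRange_ofCc μ hR).induction_on (p := fun a =>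
    T a x ∈ closure (Set.range (translateEval μ T 1))) a
    (isClosed_closure.preimage ((hT.continuous μ).clm_apply continuous_const)) fun f => ?_
  refine subset_closure ⟨Finsupp.single (f, x) 1, ?_⟩
  rw [translateEval_single, one_smul, leftTranslate_one]

variable {ν : G → ℝ≥0}

/-- This yields at once that `translateEval μ T r w` depends only on `translateEval μ T 1 w` and
that the resulting operator has norm at most ν(r). -/
theorem norm_translateEval_le [T2Space G] (hT : IsContractiveRep T)
    (hν1 : ∀ ε : ℝ, 0 < ε → ∃ V ∈ 𝓝 (1 : G), ∀ r ∈ V, (ν r : ℝ) ≤ 1 + ε)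
    (hRν : ∀ U ∈ R, ∀ r : G, ‖U.2.op r‖ ≤ ν r) (r : G)
    (w : C_c(G, 𝕂) × X →₀ 𝕂) :
    ‖translateEval μ T r w‖ ≤ ν r * ‖translateEval μ T 1 w‖ := by
  have key : ∀ ε : ℝ, 0 < ε → ‖translateEval μ T r w‖ ≤
      ν r * ((1 + ε) * ‖translateEval μ T 1 w‖) + ε := fun ε hε => by
    obtain ⟨V, hV, hVν⟩ := hν1 ε hε
    have hcont : Continuous fun s => translateEval μ T (r * s) w :=
      (continuous_translateEval μ hT w).comp (continuous_const.mul continuous_id)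
    have hW : {s | ‖translateEval μ T (r * s) w - translateEval μ T r w‖ < ε} ∈ 𝓝 (1 : G) := by
      refine (hcont.sub continuous_const).norm.continuousAt.eventually_lt continuousAt_const ?_
      simpa using hε
    -- On V the function ν is at most 1 + ε, which bounds the seminorm of u; on the second
    -- neighbourhood the average against u stays within ε of its value at the identity.
    obtain ⟨u, huV, hu1, hu2⟩ := exists_normalized_bump 𝕂 μ (Filter.inter_mem hV hW)
    have h1 := norm_integral_smul_sub_le hu1 hu2 hcont (translateEval μ T r w)
      fun s hs => (huV hs).2.le
    have h2 : ∫ s, u s • translateEval μ T (r * s) w ∂μ =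
        T (CrossedProduct.ofCc μ hR (leftTranslate r u)) (translateEval μ T 1 w) := by
      rw [apply_translateEval_one μ hT, ← integral_mul_left_eq_self (fun s => leftTranslate r u s • translateEval μ T s w) r]
      simp [leftTranslate_apply]
    have h3 : ‖CrossedProduct.ofCc μ hR u‖ ≤ 1 + ε :=
      CrossedProduct.norm_ofCc_le μ hR (by positivity) fun U hU => by
        have := U.2.norm_integrate_le μ u (M := 1 + ε) (by positivity) fun s hs =>
          (hRν U hU s).trans (hVν s (huV hs).1)
        rwa [hu1, mul_one] at this
    have h4 : ‖T (CrossedProduct.ofCc μ hR (leftTranslate r u))‖ ≤ ν r * (1 + ε) :=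
      (hT _).trans ((CrossedProduct.norm_ofCc_leftTranslate_le μ hR (ν r).coe_nonneg
        (fun U hU => hRν U hU r) u).trans (by gcongr))
    rw [h2] at h1
    calc ‖translateEval μ T r w‖
        ≤ ‖T (CrossedProduct.ofCc μ hR (leftTranslate r u)) (translateEval μ T 1 w)‖ + ε := by
          rw [norm_sub_rev] at h1
          have := norm_add_le
            (translateEval μ T r w - T (CrossedProduct.ofCc μ hR (leftTranslate r u))
              (translateEval μ T 1 w))
            (T (CrossedProduct.ofCc μ hR (leftTranslate r u)) (translateEval μ T 1 w))
          rw [sub_add_cancel] at this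
          linarith
      _ ≤ ν r * (1 + ε) * ‖translateEval μ T 1 w‖ + ε := by
          gcongr
          exact ContinuousLinearMap.le_of_opNorm_le _ h4 _
      _ = _ := by ring
  have hlim : Filter.Tendsto (fun ε : ℝ => ν r * ((1 + ε) * ‖translateEval μ T 1 w‖) + ε)
      (𝓝[>] 0) (𝓝 (ν r * ‖translateEval μ T 1 w‖)) := by
    have hc : Continuous fun ε : ℝ => (ν r : ℝ) * ((1 + ε) * ‖translateEval μ T 1 w‖) + ε := by
      fun_prop
    simpa using (hc.tendsto 0).mono_left nhdsWithin_le_nhds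
  exact ge_of_tendsto hlim (by filter_upwards [self_mem_nhdsWithin] with ε hε using key ε hε)

/-- A non-degenerate contractive representation of the crossed product is the integrated form of
a strongly continuous representation of the group. -/
theorem exists_strongContRep_of_nondegenerate [T2Space G] (hT : IsContractiveRep T)
    (hnd : IsNondegenerateRep T)
    (hν1 : ∀ ε : ℝ, 0 < ε → ∃ V ∈ 𝓝 (1 : G), ∀ r ∈ V, (ν r : ℝ) ≤ 1 + ε)
    (hν : ∀ K : Set G, IsCompact K → BddAbove (ν '' K))
    (hRν : ∀ U ∈ R, ∀ r : G, ‖U.2.op r‖ ≤ ν r) :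
    ∃ U : StrongContRep G X, (∀ r, ‖U.op r‖ ≤ ν r) ∧
      ∀ f : C_c(G, 𝕂), U.integrate μ f = T (CrossedProduct.ofCc μ hR f) := by
  have hd := denseRange_translateEval_one μ hT hnd
  have hle := norm_translateEval_le μ hT hν1 hRν
  -- The only possible U_r: it sends Σ T(f_i)x_i to Σ T(l_r f_i)x_i, extended by density.
  let S : G → X →L[𝕂] X := fun r => (translateEval μ T r).extendOfNorm (translateEval μ T 1)
  have hS : ∀ r w, S r (translateEval μ T 1 w) = translateEval μ T r w := fun r w =>
    LinearMap.extendOfNorm_eq hd ⟨ν r, hle r⟩ w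
  have hSν : ∀ r, ‖S r‖ ≤ ν r := fun r => LinearMap.opNorm_extendOfNorm_le hd (ν r).coe_nonneg (hle r)
  have hST : ∀ r s w, S r (translateEval μ T s w) = translateEval μ T (r * s) w := fun r s w => by
    induction w using Finsupp.induction_linear with
    | zero => simp
    | add v w hv hw => simp [hv, hw]
    | single p c =>
      obtain ⟨f, x⟩ := p
      have := hS r (Finsupp.single (leftTranslate s f, x) c)
      simpa only [translateEval_single, leftTranslate_one, leftTranslate_mul] using this
  have hext : ∀ A B : X →L[𝕂] X,
      (∀ w, A (translateEval μ T 1 w) = B (translateEval μ T 1 w)) → A = B := fun A B h =>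
    DFunLike.coe_injective (hd.equalizer A.continuous B.continuous (funext h))
  let φ : G →* (X →L[𝕂] X) :=
    { toFun := S
      map_one' := hext _ _ fun w => by rw [hS]; rfl
      map_mul' := fun r s => hext _ _ fun w => by
        change _ = S r (S s _)
        rw [hS, hS, hST] }
  let U : StrongContRep G X :=
    { toHom := φ.toHomUnits
      continuous_orbit := fun x => by
        change Continuous fun r => S r x
        refine continuous_iff_continuousAt.2 fun r₀ => ?_
        obtain ⟨K, hK, hKr⟩ := exists_compact_mem_nhds r₀
        obtain ⟨M, hM⟩ := hν K hK
        -- Near r₀ the orbit of x is uniformly approximated by the continuous orbit of a sum close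
        -- to x, because ν ≤ M on K. Using M + 1 keeps the divisor positive.
        refine continuousAt_of_locally_uniform_approx_of_continuousAt fun u hu => ?_
        obtain ⟨ε, hε, hεu⟩ := Metric.mem_uniformity_dist.1 hu
        have hM0 : (0 : ℝ) < M + 1 := by positivity
        obtain ⟨w, hw⟩ := hd.exists_dist_lt x (div_pos hε hM0)
        refine ⟨K, hKr, fun r => translateEval μ T r w,
          (continuous_translateEval μ hT w).continuousAt, fun r hr => hεu ?_⟩
        rw [dist_eq_norm] at hw ⊢
        change ‖S r x - translateEval μ T r w‖ < ε
        rw [← hS r w, ← map_sub]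
        calc ‖S r (x - translateEval μ T 1 w)‖ ≤ (M + 1) * ‖x - translateEval μ T 1 w‖ :=
              (S r).le_of_opNorm_le ((hSν r).trans (by
                have : (ν r : ℝ) ≤ M := NNReal.coe_le_coe.2 (hM ⟨r, hr, rfl⟩)
                linarith)) _
          _ < (M + 1) * (ε / (M + 1)) := by gcongr
          _ = ε := by field_simp }
  have hU : ∀ r, U.op r = S r := fun r => rfl
  refine ⟨U, fun r => hSν r, fun f => hext _ _ fun w => ?_⟩
  rw [U.integrate_apply μ, apply_translateEval_one μ hT]
  simp only [hU, hS]

end GroupRepOfAlgebraRep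

/-! ### Hilbert space structures and the involution -/

namespace HilbertStructure

variable {𝕂 : Type*} [RCLike 𝕂] {X : BanachSp 𝕂} (H : HilbertStructure X)

theorem ip_add_right (x y z : X) : H.ip x (y + z) = H.ip x y + H.ip x z :=
  letI := H.innerProductSpace
  inner_add_right x y z

/-- The scalar action carried by the inner product space agrees with that of X only through
`compatible`. -/
theorem ip_smul_right (x y : X) (c : 𝕂) : H.ip x (c • y) = c * H.ip x y := by
  have h := @inner_smul_right 𝕂 X _ _ H.innerProductSpace x y c
  rwa [H.compatible] at h

theorem conj_ip (x y : X) : (starRingEnd 𝕂) (H.ip y x) = H.ip x y :=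
  letI := H.innerProductSpace
  inner_conj_symm x y

theorem norm_ip_le (x y : X) : ‖H.ip x y‖ ≤ ‖x‖ * ‖y‖ :=
  letI := H.innerProductSpace
  norm_inner_le_norm x y

theorem norm_ip_self (x : X) : ‖H.ip x x‖ = ‖x‖ * ‖x‖ := by
  have h := @inner_self_eq_norm_sq_to_K 𝕂 X _ _ H.innerProductSpace x
  change ‖H.innerProductSpace.inner x x‖ = _
  rw [h, norm_pow, RCLike.norm_ofReal, abs_norm, sq]

/-- The bounded functional `y ↦ ⟨x, y⟩`. -/
def ipRight (x : X) : X →L[𝕂] 𝕂 :=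
  LinearMap.mkContinuous
    { toFun := H.ip x
      map_add' := H.ip_add_right x
      map_smul' := fun c y => H.ip_smul_right x y c } ‖x‖ (H.norm_ip_le x)

theorem ipRight_apply (x y : X) : H.ipRight x y = H.ip x y := rfl

theorem ext_ip_left {y z : X} (h : ∀ x, H.ip x y = H.ip x z) : y = z := by
  have h1 : H.ip (y - z) (y - z) = 0 := by
    rw [← H.ipRight_apply, map_sub, H.ipRight_apply, H.ipRight_apply, h, sub_self]
  have h2 := H.norm_ip_self (y - z)
  rw [h1, norm_zero, eq_comm, mul_self_eq_zero, norm_eq_zero] at h2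
  exact sub_eq_zero.1 h2

/-- `S` is the adjoint of `T`. -/
def IsAdjoint (T S : X →L[𝕂] X) : Prop :=
  ∀ x y, H.ip (T x) y = H.ip x (S y)

variable {H} {S S' T T' : X →L[𝕂] X}

theorem IsAdjoint.symm (h : H.IsAdjoint T S) : H.IsAdjoint S T := fun x y => by
  rw [← H.conj_ip, ← h, H.conj_ip]

theorem IsAdjoint.unique (h : H.IsAdjoint T S) (h' : H.IsAdjoint T S') : S = S' :=
  ContinuousLinearMap.ext fun y => H.ext_ip_left fun x => by rw [← h, ← h']

theorem IsAdjoint.mul (h : H.IsAdjoint T S) (h' : H.IsAdjoint T' S') :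
    H.IsAdjoint (T * T') (S' * S) := fun x y => by
  change H.ip (T (T' x)) y = H.ip x (S' (S y))
  rw [h, h']

/-- Cauchy–Schwarz: ‖Tx‖² = |⟨x, STx⟩| ≤ ‖ST‖ ‖x‖². -/
theorem IsAdjoint.norm_mul_self_le (h : H.IsAdjoint T S) : ‖T‖ * ‖T‖ ≤ ‖S * T‖ := by
  have h1 : ‖T‖ ≤ √‖S * T‖ := T.opNorm_le_bound (Real.sqrt_nonneg _) fun x => by
    refine nonneg_le_nonneg_of_sq_le_sq (by positivity) ?_
    calc ‖T x‖ * ‖T x‖ = ‖H.ip x ((S * T) x)‖ := by rw [← H.norm_ip_self, h]; rfl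
      _ ≤ ‖x‖ * (‖S * T‖ * ‖x‖) :=
        (H.norm_ip_le _ _).trans (by gcongr; exact (S * T).le_opNorm x)
      _ = √‖S * T‖ * √‖S * T‖ * (‖x‖ * ‖x‖) := by
        rw [Real.mul_self_sqrt (norm_nonneg _)]
        ring
      _ = √‖S * T‖ * ‖x‖ * (√‖S * T‖ * ‖x‖) := by ring
  calc ‖T‖ * ‖T‖ ≤ √‖S * T‖ * √‖S * T‖ := by gcongr
    _ = ‖S * T‖ := Real.mul_self_sqrt (norm_nonneg _)

theorem IsAdjoint.norm_le (h : H.IsAdjoint T S) : ‖T‖ ≤ ‖S‖ := by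
  have h1 := h.norm_mul_self_le.trans (norm_mul_le S T)
  rcases (norm_nonneg T).eq_or_lt with h0 | h0
  · rw [← h0]
    exact norm_nonneg S
  · exact le_of_mul_le_mul_right h1 h0

end HilbertStructure

/-! ### The involution and the C*-inequality for classes of unitary representations -/

section InvolutionOfCrossedProduct

variable {G : Type*} [Group G] [TopologicalSpace G] [IsTopologicalGroup G] [LocallyCompactSpace G]
  {𝕂 : Type*} [RCLike 𝕂] {X : BanachSp 𝕂}

theorem groupInvolution_apply (f : C_c(G, 𝕂)) (s : G) :
    groupInvolution f s = ((modularFunction s⁻¹ : ℝ) : 𝕂) * (starRingEnd 𝕂) (f s⁻¹) := rfl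

theorem groupInvolution_add (f g : C_c(G, 𝕂)) :
    groupInvolution (f + g) = groupInvolution f + groupInvolution g := by
  ext s
  simp [groupInvolution_apply, mul_add]

theorem groupInvolution_smul (c : 𝕂) (f : C_c(G, 𝕂)) :
    groupInvolution (c • f) = (starRingEnd 𝕂) c • groupInvolution f := by
  ext s
  simp only [groupInvolution_apply, CompactlySupportedContinuousMap.coe_smul, Pi.smul_apply,
    smul_eq_mul, map_mul]
  ring

variable [MeasurableSpace G] [BorelSpace G] (μ : Measure G) [μ.IsHaarMeasure]

/-- Unitarity turns ⟨U(f)x, y⟩ into ∫ conj(f(s)) ⟨x, U_{s⁻¹} y⟩ ds; the substitution s ↦ s⁻¹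
contributes the factor Δ(s⁻¹) that occurs in f*. -/
theorem HilbertStructure.isAdjoint_integrate (H : HilbertStructure X) {U : StrongContRep G X}
    (hU : ∀ (r : G) (x y : X), H.ip (U.op r x) (U.op r y) = H.ip x y) (f : C_c(G, 𝕂)) :
    H.IsAdjoint (U.integrate μ f) (U.integrate μ (groupInvolution f)) := fun x y => by
  have hinv : ∀ s, H.ip x (U.op s⁻¹ y) = (starRingEnd 𝕂) (H.ip y (U.op s x)) := fun s => by
    rw [H.conj_ip, ← hU s x, ← U.op_mul, mul_inv_cancel]
    simp [StrongContRep.op]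
  rw [← H.conj_ip, ← H.ipRight_apply, ← H.ipRight_apply, U.integrate_apply μ, U.integrate_apply μ,
    ← ContinuousLinearMap.integral_comp_comm _ (U.integrable μ f x),
    ← ContinuousLinearMap.integral_comp_comm _ (U.integrable μ _ y), ← integral_conj]
  have key := integral_modularFunction_smul_inv μ
    (φ := fun s => (starRingEnd 𝕂) (f s) * H.ip x (U.op s⁻¹ y)) ?_ ?_
  · simp only [inv_inv] at key
    simp only [H.ipRight_apply, H.ip_smul_right, map_mul, groupInvolution_apply, mul_assoc,
      ← hinv]
    rw [← key]
    congr 1 with s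
    rw [RCLike.real_smul_eq_coe_mul]
  · exact (RCLike.continuous_conj.comp (map_continuous f)).mul
      ((H.ipRight x).continuous.comp ((U.continuous_op y).comp continuous_inv))
  · refine HasCompactSupport.mul_right ?_
    exact f.hasCompactSupport.comp_left (g := starRingEnd 𝕂) (map_zero _)

variable {R : Set (SomeRep G 𝕂)} (hR : UniformlyBoundedClass R)

theorem exists_isAdjoint_integrate (hu : ∀ U ∈ R, IsUnitaryRep U.2) {U : SomeRep G 𝕂}
    (hU : U ∈ R) : ∃ H : HilbertStructure U.1, ∀ f : C_c(G, 𝕂),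
      H.IsAdjoint (U.2.integrate μ f) (U.2.integrate μ (groupInvolution f)) := by
  obtain ⟨H, hH⟩ := hu U hU
  exact ⟨H, H.isAdjoint_integrate μ hH⟩

namespace CrossedProduct

/-- An adjoint has no larger norm, in each U. This is the bound that lets the involution extend to
the completion. -/
theorem norm_ofCc_groupInvolution_le (hu : ∀ U ∈ R, IsUnitaryRep U.2) (f : C_c(G, 𝕂)) :
    ‖ofCc μ hR (groupInvolution f)‖ ≤ ‖ofCc μ hR f‖ :=
  norm_ofCc_le μ hR (norm_nonneg _) fun U hU => by
    obtain ⟨H, hH⟩ := exists_isAdjoint_integrate μ hu hU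
    rw [norm_ofCc]
    exact (hH f).symm.norm_le.trans (norm_integrate_le_classSeminorm μ hR hU f)

/-- The involution of the crossed product: the extension of that of `C_c(G)`. -/
def involution : CrossedProduct μ R hR →SL[starRingEnd 𝕂] CrossedProduct μ R hR :=
  LinearMap.extendOfNorm
    { toFun := fun f => ofCc μ hR (groupInvolution f)
      map_add' := fun f g => by rw [groupInvolution_add, map_add]
      map_smul' := fun c f => by rw [groupInvolution_smul, map_smul] } (ofCc μ hR)

theorem involution_ofCc (hu : ∀ U ∈ R, IsUnitaryRep U.2) (f : C_c(G, 𝕂)) :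
    involution μ hR (ofCc μ hR f) = ofCc μ hR (groupInvolution f) :=
  LinearMap.extendOfNorm_eq (denseRange_ofCc μ hR)
    ⟨1, fun f => (norm_ofCc_groupInvolution_le μ hR hu f).trans_eq (one_mul _).symm⟩ f

/-- The star ring structure of the crossed product of a class of unitary representations. -/
@[reducible]
def starRing (hu : ∀ U ∈ R, IsUnitaryRep U.2) : StarRing (CrossedProduct μ R hR) where
  star := involution μ hR
  star_involutive a := by
    refine (denseRange_ofCc μ hR).induction_on
      (p := fun a => involution μ hR (involution μ hR a) = a) a
      (isClosed_eq (by fun_prop) continuous_id) fun f => ?_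
    rw [involution_ofCc μ hR hu, involution_ofCc μ hR hu]
    -- Both sides act in U as the adjoint of the same operator, so no computation with Δ is needed.
    refine ofCc_eq_of_integrate_eq μ hR fun U hU => ?_
    obtain ⟨H, hH⟩ := exists_isAdjoint_integrate μ hu hU
    exact (hH _).unique (hH f).symm
  star_mul a b := by
    refine (denseRange_ofCc μ hR).induction_on₂
      (p := fun a b => involution μ hR (a * b) = involution μ hR b * involution μ hR a)
      (isClosed_eq (by fun_prop) (by fun_prop)) (fun f g => ?_) a b
    rw [ofCc_mul_ofCc, involution_ofCc μ hR hu, involution_ofCc μ hR hu, involution_ofCc μ hR hu,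
      ofCc_mul_ofCc]
    refine ofCc_eq_of_integrate_eq μ hR fun U hU => ?_
    obtain ⟨H, hH⟩ := exists_isAdjoint_integrate μ hu hU
    have h := hH (groupConvolution μ f g)
    rw [U.2.integrate_groupConvolution μ] at h
    rw [U.2.integrate_groupConvolution μ]
    exact h.unique ((hH f).mul (hH g))
  star_add := map_add (involution μ hR)

/-- For f in C_c(G), ‖U(f)‖² ≤ ‖U(f* * f)‖ ≤ σ(f* * f) for every U in R. Taking square roots puts
this in the form of a bound on the supremum σ(f). -/
theorem norm_mul_self_le_norm_involution_mul_self (hu : ∀ U ∈ R, IsUnitaryRep U.2)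
    (a : CrossedProduct μ R hR) : ‖a‖ * ‖a‖ ≤ ‖involution μ hR a * a‖ := by
  refine (denseRange_ofCc μ hR).induction_on
    (p := fun a => ‖a‖ * ‖a‖ ≤ ‖involution μ hR a * a‖) a
    (isClosed_le (by fun_prop) (by fun_prop)) fun f => ?_
  rw [involution_ofCc μ hR hu, ofCc_mul_ofCc]
  set g := groupConvolution μ (groupInvolution f) f with hg
  have h1 : ‖ofCc μ hR f‖ ≤ √‖ofCc μ hR g‖ :=
    norm_ofCc_le μ hR (Real.sqrt_nonneg _) fun U hU => by
      obtain ⟨H, hH⟩ := exists_isAdjoint_integrate μ hu hU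
      refine Real.le_sqrt_of_sq_le ?_
      rw [sq, norm_ofCc]
      refine (hH f).norm_mul_self_le.trans ?_
      rw [← U.2.integrate_groupConvolution μ]
      exact norm_integrate_le_classSeminorm μ hR hU g
  calc ‖ofCc μ hR f‖ * ‖ofCc μ hR f‖ ≤ √‖ofCc μ hR g‖ * √‖ofCc μ hR g‖ := by gcongr
    _ = ‖ofCc μ hR g‖ := Real.mul_self_sqrt (norm_nonneg _)

end CrossedProduct

theorem StrongContRep.isInvolutiveRep_induced (hu : ∀ U ∈ R, IsUnitaryRep U.2) {U : SomeRep G 𝕂}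
    (hU : U ∈ R) :
    letI := CrossedProduct.starRing μ hR hu
    IsInvolutiveRep (U.2.induced μ hR (continuousFor_of_mem μ hR hU)) := by
  obtain ⟨H, hH⟩ := exists_isAdjoint_integrate μ hu hU
  refine ⟨H, fun a x y => ?_⟩
  change _ = H.ip x (U.2.induced μ hR _ (CrossedProduct.involution μ hR a) y)
  have hc := StrongContRep.continuous_induced μ hR (continuousFor_of_mem μ hR hU)
  -- Conjugation moves the operator to the second slot, where the inner product is a bounded
  -- functional; both sides are then visibly continuous in a.
  rw [← H.conj_ip, ← H.ipRight_apply, ← H.ipRight_apply]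
  refine (CrossedProduct.denseRange_ofCc μ hR).induction_on (p := fun a =>
    (starRingEnd 𝕂) (H.ipRight y (U.2.induced μ hR (continuousFor_of_mem μ hR hU) a x)) =
      H.ipRight x (U.2.induced μ hR (continuousFor_of_mem μ hR hU)
        (CrossedProduct.involution μ hR a) y)) a (isClosed_eq ?_ ?_) fun f => ?_
  · exact RCLike.continuous_conj.comp ((H.ipRight y).continuous.comp
      (hc.clm_apply continuous_const))
  · exact (H.ipRight x).continuous.comp ((hc.comp
      (CrossedProduct.involution μ hR).continuous).clm_apply continuous_const)
  · rw [CrossedProduct.involution_ofCc μ hR hu, StrongContRep.induced_ofCc,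
      StrongContRep.induced_ofCc, H.ipRight_apply, H.ipRight_apply, H.conj_ip]
    exact hH f x y

end InvolutionOfCrossedProduct

end

/-! ### The correspondence between R' and the representations of the crossed product -/

theorem theoremt {𝕂 : Type w} [RCLike 𝕂]
    {G : Type u} [Group G] [TopologicalSpace G] [IsTopologicalGroup G] [LocallyCompactSpace G]
    [T2Space G] [MeasurableSpace G] [BorelSpace G] (μ : Measure G) [μ.IsHaarMeasure]
    (𝓩 : Set (Set G)) (h𝓩 : (𝓝 (1 : G)).HasBasis (fun V : Set G => V ∈ 𝓩) id)
    (K₀ : Set G) (hK₀ : IsCompact K₀) (h𝓩K₀ : ∀ V ∈ 𝓩, V ⊆ K₀)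
    (ν : G → ℝ≥0) (hν : ∀ K : Set G, IsCompact K → BddAbove (ν '' K))
    (hν1 : (⨅ V : 𝓩, ⨆ r : (V : Set G), ν r) = 1)
    (R : Set (SomeRep.{u, w, v} G 𝕂)) (hRne : R.Nonempty)
    (hRν : ∀ U ∈ R, ∀ r : G, ‖U.2.op r‖ ≤ ν r)
    (𝓧 : Set (BanachSp.{w, v} 𝕂)) (hsub : boundedReps 𝓧 ν ⊆ R) :
    let hR : UniformlyBoundedClass R := ⟨ν, hν, hRν⟩
    let Ψ : boundedReps 𝓧 ν → SomeAlgRep.{max u w, w, v} (𝕂 := 𝕂) (CrossedProduct μ R hR) :=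
      fun U => inducedRep μ hR U.1 (hsub U.2)
    -- `U ↦ U^R` is a bijection onto the non-degenerate contractive representations
    (Function.Injective Ψ ∧
      Set.range Ψ = nondegContractiveReps (CrossedProduct μ R hR) 𝓧) ∧
    -- it preserves the set of closed invariant subspaces
    (∀ (U : boundedReps 𝓧 ν) (Z : Submodule 𝕂 U.1.1), IsClosed (Z : Set U.1.1) →
      (IsInvariantUnder (fun r : G => U.1.2.op r) Z ↔
        IsInvariantUnder (fun a : CrossedProduct μ R hR => (Ψ U).2 a) Z)) ∧
    -- it preserves the bounded intertwining operators
    (∀ (U V : boundedReps 𝓧 ν) (Φ : U.1.1 →L[𝕂] V.1.1),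
      Intertwines (fun r : G => U.1.2.op r) (fun r : G => V.1.2.op r) Φ ↔
        Intertwines (fun a : CrossedProduct μ R hR => (Ψ U).2 a)
          (fun a : CrossedProduct μ R hR => (Ψ V).2 a) Φ) ∧
    -- if all elements of `R` are unitary, the crossed product is a `C*`-algebra, with the
    -- involution extending that of `C_c(G)`, and unitary corresponds to involutive
    ((∀ U ∈ R, IsUnitaryRep U.2) →
      ∃ _ : StarRing (CrossedProduct μ R hR),
        StarModule 𝕂 (CrossedProduct μ R hR) ∧ CStarRing (CrossedProduct μ R hR) ∧
        (∀ f : C_c(G, 𝕂), star (CrossedProduct.q μ R hR f) =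
          CrossedProduct.q μ R hR (groupInvolution f)) ∧
        ∀ U : boundedReps 𝓧 ν, IsUnitaryRep U.1.2 ↔ IsInvolutiveRep (Ψ U).2) := by
  intro hR Ψ
  have hν1' : ∀ ε : ℝ, 0 < ε → ∃ V ∈ 𝓝 (1 : G), ∀ r ∈ V, (ν r : ℝ) ≤ 1 + ε := fun ε hε =>
    exists_nhds_le_one_add h𝓩 hK₀ h𝓩K₀ hν hν1 hε
  have hc : ∀ U : boundedReps 𝓧 ν, U.1.2.ContinuousFor μ R := fun U =>
    continuousFor_of_mem μ hR (hsub U.2)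
  refine ⟨⟨?_, Set.Subset.antisymm ?_ ?_⟩, fun U Z hZ => ?_, fun U V Φ => ?_, fun hu => ?_⟩
  · rintro ⟨⟨X, U⟩, hU⟩ ⟨⟨Y, V⟩, hV⟩ h
    obtain rfl : X = Y := congrArg Sigma.fst h
    have h' := eq_of_heq (Sigma.mk.inj h).2
    obtain rfl : U = V := StrongContRep.eq_of_induced_eq μ hR _ _ h'
    rfl
  · rintro _ ⟨U, rfl⟩
    exact ⟨U.2.1, StrongContRep.isNondegenerateRep_induced μ hR (hc U),
      StrongContRep.norm_induced_le μ hR (hsub U.2)⟩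
  · rintro ⟨X, T⟩ ⟨hX, hnd, hT⟩
    obtain ⟨U, hUν, hUT⟩ := exists_strongContRep_of_nondegenerate μ hT hnd hν1' hν hRν
    -- The exact bound ν(r) puts U in R', hence in R, so that U^R is available to be compared with T
    -- on the image of C_c(G).
    have hU : (⟨X, U⟩ : SomeRep G 𝕂) ∈ boundedReps 𝓧 ν := ⟨hX, hUν⟩
    refine ⟨⟨⟨X, U⟩, hU⟩, ?_⟩
    refine congrArg (Sigma.mk X) (DFunLike.coe_injective ?_)
    refine (CrossedProduct.denseRange_ofCc μ hR).equalizer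
      (StrongContRep.continuous_induced μ hR (hc ⟨⟨X, U⟩, hU⟩)) (hT.continuous μ) ?_
    funext f
    exact (StrongContRep.induced_ofCc μ hR (hc ⟨⟨X, U⟩, hU⟩) f).trans (hUT f)
  · exact StrongContRep.isInvariantUnder_induced_iff μ hR (hc U) hZ
  · exact StrongContRep.intertwines_induced_iff μ hR (hc U) (hc V) Φ
  · let _ := CrossedProduct.starRing μ hR hu
    -- In the last equivalence both sides hold outright: R' lies in R, whose members are all
    -- unitary.
    refine ⟨inferInstance, ⟨fun c a => map_smulₛₗ (CrossedProduct.involution μ hR) c a⟩,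
      ⟨CrossedProduct.norm_mul_self_le_norm_involution_mul_self μ hR hu⟩,
      CrossedProduct.involution_ofCc μ hR hu, fun U =>
        ⟨fun _ => StrongContRep.isInvolutiveRep_induced μ hR hu (hsub U.2),
          fun _ => hu U.1 (hsub U.2)⟩⟩
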